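/- **Market.** Let $A$ be a finite nonempty set of agents. The goods are bread (good $0$) and digital categories $1,\dots,g$ ($g\ge 0$). Category $j\ge 1$ starts with a finite nonempty set $S_j$ of initial songs, each owned by exactly one agent. Each agent $i$ has a compact convex set $P_i\subset\mathbb R_+^{g+1}$ of feasible productions containing a point with positive bread production; a coarse utility $f_i:\mathbb R_+^{g+1}\to\mathbb R_+$ that is continuous, quasi-concave and non-satiated in every good (more of any good is strictly better); and, for each $j\ge1$, a strict total order $T_{ij}$ on the sources $A\cup S_j$ (agents as producers of songs, and initial songs). Given productions $y$, source $k$ offers $y_{kj}$ songs, with $y_{kj}=1$ for $k\in S_j$; put $Y_j=\sum_{k\in A\cup S_j}y_{kj}$. An allocation $x$ specifies quantities $x_{ij}$ for all goods $j\ge 0$ and, for $j\ge1$, the quantity $x_{ijk}$ that $i$ obtains from source $k$. For $j\ge 1$ let $R_{ij}(k)=\max\{0,\ x_{ij}-\sum_{k' \text{ above } k \text{ in } T_{ij}}y_{k'j}\}$. The earnings of $i$ at $(p,x,y)$ are $$p_0y_{i0}+\sum_{j\ge1}p_j\Big(\sum_{k\in S_j \text{ owned by } i}\ \sum_{b\in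 A}x_{bjk}+\sum_{b\in A}x_{bji}\Big).$$ A production $v\in P_i$ is *optimal* for $i$ at $(p,x,y)$ if it maximizes over $P_i$ $$p_0v_0+\sum_{j\ge1}p_j\Big(\sum_{k\in S_j\text{ owned by }i}\ \sum_{b\in A}x_{bjk}+\sum_{b\in A}\min\{v_j,R_{bj}(i)\}\Big)$$ (this depends only on $p$, $x$ and the productions of the others). An allocation of agent $i$ is an *optimal detailed allocation* for prices $p$, money $w$ and productions $y$ if $(x_{ij})_{j\ge0}\in\mathbb R_+^{g+1}$ maximizes $f_i(z)$ over $z\in\mathbb R_+^{g+1}$ with $\sum_j p_jz_j\le w$, and $x_{ijk}=\min\{y_{kj},R_{ij}(k)\}$ for all $j\ge 1$ and $k$ (songs are taken in the order $T_{ij}$). **Equilibrium.** $(p,x,y)$ with $p\ge0$ is an equilibrium if (1) each $y_i$ is an optimal production of $i$ at $(p,x,y)$; (2) each $x_i$ is an optimal detailed allocation for prices $p$, the money earned by $i$ at $(p,x,y)$, and productions $y$; (3) the market clears: $\sum_i x_{i0}=\sum_i y_{i0}$; for every $j\ge 1$ with $p_j>0$ and every $k\in A\cup S_j$ some agent $i$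 has $x_{ijk}=y_{kj}$; and $x_{ij}\le Y_j$ for all $i$ and all $j\ge1$. **Correspondence.** Let $M$ be such that $\sum_iy_{i0}\le M$ and $Y_j\le M$ ($j\ge1$) for all feasible productions $y$. Let $D=[0,1.1M]$ and let $\Delta_g\subset\mathbb R^{g+1}$ be the unit simplex. Put $b(j)=\sum_ix_{ij}$ for $j\ge 0$, $s(0)=\sum_iy_{i0}$, and $s(j)=\sum_{k\in A\cup S_j}\big(y_{kj}-\max_ix_{ijk}+\sum_ix_{ijk}\big)$ for $j\ge1$. Then $(p',x',y')\in F(p,x,y)$ iff $p'\in\Delta_g$; all coordinates of $x'$ and $y'$ lie in $D$; for each $i$, $x'_i$ is an optimal detailed allocation for prices $p$, the money earned by $i$ at $(p,x,y)$, and productions $y$, with $f_i$ replaced by its flattening $z\mapsto f_i\big((\min\{z_j,1.1M\})_j\big)$; for each $i$, $y'_i$ is an optimal production of $i$ at $(p,x,y)$; and $$p'\in\operatorname*{argmax}_{q\in\Delta_g}\Big\{q_0\frac{b(0)+1}{s(0)+1}+\sum_{j=1}^gq_j\frac{b(j)}{s(j)}\Big\}.$$ **Theorem.** For every such $M$ and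 every triple $(p,x,y)$ one has $(p,x,y)\in F(p,x,y)$ if and only if $p\in\Delta_g$ and $(p,x,y)$ is an equilibrium of the market. Moreover, every such market has an equilibrium $(p,x,y)$ with $p\in\Delta_g$. -/

import Mathlib

/-!
A mixed market with one conventional good ("bread") and finitely many digital categories.

Agents form the type `A`, digital categories the type `J`, and `S j` is the set of initial songs of
category `j`. Goods are `Option J`: `none` is bread, `some j` is category `j`. The sources of songs
in category `j` are `A ⊕ S j`: `Sum.inl i` stands for the songs produced by agent `i`,
`Sum.inr k` for the initial song `k`.
-/

open scoped BigOperators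

/-- The primitives of the market, with the standing assumptions on them. -/
structure DigitalMarket (A J : Type*) (S : J → Type*) [Fintype A] [Fintype J] where
  /-- Each initial song has a unique owner. -/
  owner : ∀ j, S j → A
  /-- The set of feasible production points of each agent. -/
  feasible : A → Set (Option J → ℝ)
  feasible_nonneg : ∀ i, ∀ y ∈ feasible i, 0 ≤ y
  feasible_compact : ∀ i, IsCompact (feasible i)
  feasible_convex : ∀ i, Convex ℝ (feasible i)
  /-- Every agent has the option of producing a positive amount of bread. -/
  feasible_bread : ∀ i, ∃ y ∈ feasible i, 0 < y none
  /-- The coarse utility functions, considered on the nonnegative orthant only. -/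
  utility : A → (Option J → ℝ) → ℝ
  utility_nonneg : ∀ i, ∀ z, 0 ≤ z → 0 ≤ utility i z
  utility_continuous : ∀ i, ContinuousOn (utility i) (Set.Ici 0)
  utility_quasiconcave : ∀ i, QuasiconcaveOn ℝ (Set.Ici 0) (utility i)
  /-- Non-satiation in every good: more of any good is strictly better. -/
  utility_nonsatiated : ∀ i, StrictMonoOn (utility i) (Set.Ici 0)
  /-- `prefers i j k k'`: in category `j`, agent `i` ranks the source `k` above the source `k'`. -/
  prefers : A → ∀ j, A ⊕ S j → A ⊕ S j → Prop
  prefers_total : ∀ i j, IsStrictTotalOrder (A ⊕ S j) (prefers i j)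

/-- Prices, detailed allocations and productions. The allocation consists of the quantity
`amount i c` of every good that agent `i` obtains, and of the part `detail i j k` of the quantity
`amount i (some j)` that comes from the source `k`. (If `amount i (some j)` exceeds the number of
available songs, the `detail i j k` do not add up to it; the difference is excess demand.) -/
@[ext]
structure MarketState (A J : Type*) (S : J → Type*) where
  price : Option J → ℝ
  amount : A → Option J → ℝ
  detail : A → ∀ j, A ⊕ S j → ℝ
  production : A → Option J → ℝ

namespace DigitalMarket

noncomputable section

open scoped Classical

variable {A J : Type*} {S : J → Type*} [Fintype A] [Fintype J] [∀ j, Fintype (S j)]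

/-- The number of songs available from a source: what the agent produces, or one initial song. -/
def available (y : A → Option J → ℝ) (j : J) : A ⊕ S j → ℝ
  | Sum.inl i => y i (some j)
  | Sum.inr _ => 1

/-- The total number of songs available in category `j`. -/
def totalAvailable (S : J → Type*) [∀ j, Fintype (S j)] (y : A → Option J → ℝ) (j : J) : ℝ :=
  ∑ k : A ⊕ S j, available y j k

/-- If agent `i` is to obtain `q` songs of category `j`, this is the part of `q` left over
after all sources that `i` ranks above `k` have been used up. -/
def residual (m : DigitalMarket A J S) (y : A → Option J → ℝ) (i : A) (j : J) (q : ℝ)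
    (k : A ⊕ S j) : ℝ :=
  max 0 (q - ∑ k' : A ⊕ S j with m.prefers i j k' k, available y j k')

/-- Coarse bundle `z` is optimal for the utility `u` at prices `p` with the amount `w` of money. -/
def IsOptimalBundle (u : (Option J → ℝ) → ℝ) (p : Option J → ℝ) (w : ℝ)
    (z : Option J → ℝ) : Prop :=
  0 ≤ z ∧ ∑ c, p c * z c ≤ w ∧
    ∀ z' : Option J → ℝ, 0 ≤ z' → ∑ c, p c * z' c ≤ w → u z' ≤ u z

/-- `(z, x)` is an optimal detailed allocation of agent `i`: the coarse allocation `z` is optimal,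
and in every category the songs are taken in the order of `i`'s ranking. -/
def IsOptimalDetailed (m : DigitalMarket A J S) (u : (Option J → ℝ) → ℝ) (p : Option J → ℝ)
    (w : ℝ) (y : A → Option J → ℝ) (i : A) (z : Option J → ℝ) (x : ∀ j, A ⊕ S j → ℝ) : Prop :=
  IsOptimalBundle u p w z ∧
    ∀ j k, x j k = min (available y j k) (m.residual y i j (z (some j)) k)

/-- The number of copies of initial songs of category `j` owned by `i` that are sold. -/
def ownedSales (m : DigitalMarket A J S) (x : A → ∀ j, A ⊕ S j → ℝ) (i : A) (j : J) : ℝ :=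
  ∑ k : S j with m.owner j k = i, ∑ b : A, x b j (Sum.inr k)

/-- The earnings of agent `i`: from her bread, and from all copies sold of songs that she owns
or produces. -/
def earnings (m : DigitalMarket A J S) (e : MarketState A J S) (i : A) : ℝ :=
  e.price none * e.production i none +
    ∑ j, e.price (some j) * (m.ownedSales e.detail i j + ∑ b : A, e.detail b j (Sum.inl i))

/-- The earnings of agent `i` if she produces `v`, given prices, allocations and the digital
production of the other agents: the sales of the initial songs are those of the given allocation,
and buyer `b` buys the songs produced by `i` up to what is left of `b`'s quantity after the sources
that `b` ranks above `i` (`residual` at `Sum.inl i` does not depend on `i`'s own production). -/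
def potentialEarnings (m : DigitalMarket A J S) (e : MarketState A J S) (i : A)
    (v : Option J → ℝ) : ℝ :=
  e.price none * v none +
    ∑ j, e.price (some j) * (m.ownedSales e.detail i j +
      ∑ b : A, min (v (some j)) (m.residual e.production b j (e.amount b (some j)) (Sum.inl i)))

/-- `v` is an optimal production of agent `i`. -/
def IsOptimalProduction (m : DigitalMarket A J S) (e : MarketState A J S) (i : A)
    (v : Option J → ℝ) : Prop :=
  v ∈ m.feasible i ∧
    ∀ v' ∈ m.feasible i, m.potentialEarnings e i v' ≤ m.potentialEarnings e i v

/-- Market clearing. -/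
def MarketClears (e : MarketState A J S) : Prop :=
  (∑ i, e.amount i none = ∑ i, e.production i none) ∧
  (∀ j, 0 < e.price (some j) →
    ∀ k : A ⊕ S j, ∃ i, e.detail i j k = available e.production j k) ∧
  (∀ i j, e.amount i (some j) ≤ totalAvailable S e.production j)

/-- Equilibrium of the market. -/
structure IsEquilibrium (m : DigitalMarket A J S) (e : MarketState A J S) : Prop where
  price_nonneg : 0 ≤ e.price
  optimal_production : ∀ i, m.IsOptimalProduction e i (e.production i)
  optimal_allocation : ∀ i,
    m.IsOptimalDetailed (m.utility i) e.price (m.earnings e i) e.production i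
      (e.amount i) (e.detail i)
  clears : MarketClears e

/-- `M` bounds the number of units of bread, and the number of songs of each category (initial
songs included), that can ever be available. -/
def IsSupplyBound (m : DigitalMarket A J S) (M : ℝ) : Prop :=
  ∀ y : A → Option J → ℝ, (∀ i, y i ∈ m.feasible i) →
    ∑ i, y i none ≤ M ∧ ∀ j, totalAvailable S y j ≤ M

/-- The utility of agent `i`, flattened out in every good after `1.1 M` units. -/
def flatUtility (m : DigitalMarket A J S) (M : ℝ) (i : A) (z : Option J → ℝ) : ℝ :=
  m.utility i (fun c => min (z c) (1.1 * M))

/-- Excess supply of the source `k` in category `j`. -/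
def excessSupply (e : MarketState A J S) (j : J) (k : A ⊕ S j) : ℝ :=
  available e.production j k - ⨆ i, e.detail i j k

/-- The number of units bought of each good. -/
def bought (e : MarketState A J S) (c : Option J) : ℝ :=
  ∑ i, e.amount i c

/-- The number of units sold of each good (for digital categories, excess supply being bought by
a fictitious market maker). -/
def sold (e : MarketState A J S) : Option J → ℝ
  | none => ∑ i, e.production i none
  | some j => ∑ k : A ⊕ S j, (excessSupply e j k + ∑ i, e.detail i j k)

/-- The objective maximized in the price update. -/
def priceObjective (e : MarketState A J S) (q : Option J → ℝ) : ℝ :=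
  q none * ((bought e none + 1) / (sold e none + 1)) +
    ∑ j, q (some j) * (bought e (some j) / sold e (some j))

/-- The domain of the correspondence. -/
def domain (S : J → Type*) (M : ℝ) : Set (MarketState A J S) :=
  {e | e.price ∈ stdSimplex ℝ (Option J) ∧
    (∀ i c, e.amount i c ∈ Set.Icc 0 (1.1 * M)) ∧
    (∀ i j k, e.detail i j k ∈ Set.Icc 0 (1.1 * M)) ∧
    (∀ i c, e.production i c ∈ Set.Icc 0 (1.1 * M))}

/-- The correspondence whose fixed points are studied. -/
def correspondence (m : DigitalMarket A J S) (M : ℝ) (e : MarketState A J S) :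
    Set (MarketState A J S) :=
  {e' | e' ∈ domain S M ∧
    (∀ i, m.IsOptimalDetailed (m.flatUtility M i) e.price (m.earnings e i) e.production i
      (e'.amount i) (e'.detail i)) ∧
    (∀ i, m.IsOptimalProduction e i (e'.production i)) ∧
    IsMaxOn (priceObjective e) (stdSimplex ℝ (Option J)) e'.price}

end

end DigitalMarket

/-! At a fixed point nobody overspends, and earnings come only from sales. So the value of what is
bought is at most the value of what is sold, counting the market maker's purchases of excess supply
(`sum_price_mul_bought_le`). The maximizing prices are supported on the goods with the largest ratio
of demand to supply. Were this ratio above 1, every good with a positive price would be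
overdemanded, against the inequality; hence no good is (`bought_le_sold`). All quantities are then
at most `M`, below the level where flattening sets in, and quasi-concavity makes the chosen bundles
optimal for the true utilities (`of_flat`). Non-satiation gives positive prices and exhausted
budgets. The digital terms cancel in the budget identity, so bread clears, its ratio is 1, all other
ratios are 1 as well, and no source has excess supply (`marketClears`). Conversely, clearing makes
every ratio 1, so every price vector is a maximizer.

Existence does not follow from Kakutani's theorem for `correspondence` itself: details depend
non-linearly on quantities, which spoils convexity, and demand need not have a closed graph where an
income vanishes. The theorem is applied instead to coarse states, with details recomputed greedily,
and to quasi-demands, which compete only with strictly cheaper bundles (`coarseResponse`). At a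
fixed point bread has a positive price; everyone can produce bread, so incomes are positive and
quasi-demands are demands.

Kakutani's theorem is reduced to Brouwer's by weights on a finite net, and Brouwer's to Scarf's
lemma on rankings of a finite set (`exists_dominant_colored`), which is a parity count of doors and
rooms. -/

namespace Scarf

/-! ### Combinatorics of dominant sets -/

section Cells

variable {I Y : Type*}

/-- A finite set `σ` is dominant for the rankings `r i` if no point lies, in every ranking,
strictly above the lowest point of `σ`. -/
def Dominant (r : I → Y → ℕ) (σ : Finset Y) : Prop :=
  ∀ y, ∃ i, ∀ x ∈ σ, r i y ≤ r i x

lemma Dominant.mono {r : I → Y → ℕ} {σ τ : Finset Y} (h : Dominant r σ) (hτ : τ ⊆ σ) :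
    Dominant r τ := fun y => (h y).imp fun _ hi x hx => hi x (hτ hx)

/-- `y` lies above the lowest point of `τ` in every ranking other than `d`. -/
def Beats (r : I → Y → ℕ) (τ : Finset Y) (d : I) (y : Y) : Prop :=
  ∀ i, i ≠ d → ∃ x ∈ τ, r i x < r i y

/-- `x` is the `d`-highest among the points that beat `τ` in all rankings other than `d`. -/
def IsTop (r : I → Y → ℕ) (τ : Finset Y) (d : I) (x : Y) : Prop :=
  Beats r τ d x ∧ ∀ y, Beats r τ d y → r d y ≤ r d x

lemma IsTop.unique {r : I → Y → ℕ} (hr : ∀ i, Function.Injective (r i)) {τ : Finset Y} {d : I}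
    {x x' : Y} (h : IsTop r τ d x) (h' : IsTop r τ d x') : x = x' :=
  hr d (le_antisymm (h'.2 x h.1) (h.2 x' h'.1))

lemma exists_isTop [Finite Y] {r : I → Y → ℕ} {τ : Finset Y} {d : I}
    (h : ∃ y, Beats r τ d y) : ∃ x, IsTop r τ d x := by
  classical
  have := Fintype.ofFinite Y
  obtain ⟨y, hy⟩ := h
  obtain ⟨x, hx, hmax⟩ := Finset.exists_max_image (Finset.univ.filter (Beats r τ d)) (r d)
    ⟨y, by simpa using hy⟩
  exact ⟨x, by simpa using hx, fun z hz => hmax z (by simpa using hz)⟩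

lemma exists_lowest (r : I → Y → ℕ) {σ : Finset Y} (hσ : σ.Nonempty) :
    ∃ l : I → Y, ∀ i, l i ∈ σ ∧ ∀ x ∈ σ, r i (l i) ≤ r i x := by
  choose l hl using fun i => Finset.exists_min_image σ (r i) hσ
  exact ⟨l, hl⟩

/-- Dominance tested at `x` itself yields a ranking in which no point of `σ` lies below `x`. -/
lemma Dominant.exists_lowest_eq {r : I → Y → ℕ} (hr : ∀ i, Function.Injective (r i))
    {σ : Finset Y} (h : Dominant r σ) {l : I → Y}
    (hl : ∀ i, l i ∈ σ ∧ ∀ x ∈ σ, r i (l i) ≤ r i x) {x : Y} (hx : x ∈ σ) : ∃ i, l i = x := by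
  obtain ⟨i, hi⟩ := h x
  exact ⟨i, hr i (le_antisymm ((hl i).2 x hx) (hi _ (hl i).1))⟩

/-- A nonempty dominant set with one point less than there are rankings can be completed to a
dominant set in at most two ways. -/
lemma exists_completions [Fintype I] [DecidableEq Y] {r : I → Y → ℕ}
    (hr : ∀ i, Function.Injective (r i)) {τ : Finset Y} (hne : τ.Nonempty) (hτ : Dominant r τ)
    (hcard : τ.card + 1 = Fintype.card I) :
    ∃ d₁ d₂ : I, d₁ ≠ d₂ ∧
      ∀ x, (x ∉ τ ∧ Dominant r (insert x τ)) ↔ IsTop r τ d₁ x ∨ IsTop r τ d₂ x := by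
  obtain ⟨l, hl⟩ := exists_lowest r hne
  -- `τ` has one point fewer than there are rankings, so two rankings share their lowest point. A
  -- completing point must become lowest in one of these two.
  have hninj : ¬ Function.Injective l := by
    intro hinj
    have := Finset.card_le_card_of_injOn (s := Finset.univ) (t := τ) l (fun i _ => (hl i).1)
      hinj.injOn
    rw [Finset.card_univ] at this
    omega
  obtain ⟨d₁, d₂, heq, hne12⟩ : ∃ d₁ d₂, l d₁ = l d₂ ∧ d₁ ≠ d₂ := by
    simpa [Function.Injective] using hninj
  refine ⟨d₁, d₂, hne12, fun x => ⟨?_, ?_⟩⟩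
  · rintro ⟨hx, hdom⟩
    obtain ⟨l', hl'⟩ := exists_lowest r (Finset.insert_nonempty x τ)
    -- Each of the `|I|` points is lowest in some ranking, hence in exactly one.
    have hinj : Function.Injective l' := by
      have := Finset.injOn_of_surjOn_of_card_le (s := Finset.univ) (t := insert x τ) l'
        (fun i _ => (hl' i).1)
        (fun z hz => by
          obtain ⟨i, hi⟩ := hdom.exists_lowest_eq hr hl' hz
          exact ⟨i, by simp, hi⟩)
        (by rw [Finset.card_insert_of_notMem hx, hcard, Finset.card_univ])
      simpa [Set.injOn_univ] using this
    obtain ⟨d, hd⟩ := hdom.exists_lowest_eq hr hl' (Finset.mem_insert_self x τ)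
    have hmem : ∀ i, i ≠ d → l' i ∈ τ := by
      intro i hi
      rcases Finset.mem_insert.1 (hl' i).1 with h | h
      · exact absurd (hinj (h.trans hd.symm)) hi
      · exact h
    have htop : IsTop r τ d x := by
      refine ⟨fun i hi => ⟨l' i, hmem i hi, lt_of_le_of_ne
        ((hl' i).2 x (Finset.mem_insert_self x τ)) fun h => hx ?_⟩, fun y hy => ?_⟩
      · rw [← hr i h]; exact hmem i hi
      · obtain ⟨i, hi⟩ := hdom y
        by_cases hid : i = d
        · subst hid; exact hi x (Finset.mem_insert_self x τ)
        · obtain ⟨z, hz, hlt⟩ := hy i hid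
          exact absurd (hi z (Finset.mem_insert_of_mem hz)) (not_le.2 hlt)
    -- Adding `x` changes the lowest point only in the ranking `d`. Injectivity of `l'` has to break
    -- the coincidence `l d₁ = l d₂`, so `d` is one of the two.
    have hll : ∀ i, i ≠ d → l' i = l i := fun i hi =>
      hr i (le_antisymm ((hl' i).2 _ (Finset.mem_insert_of_mem (hl i).1))
        ((hl i).2 _ (hmem i hi)))
    by_cases h1 : d₁ = d
    · left; rwa [h1]
    by_cases h2 : d₂ = d
    · right; rwa [h2]
    exact absurd (hinj (by rw [hll d₁ h1, hll d₂ h2, heq])) hne12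
  · have key : ∀ d d', d ≠ d' → l d = l d' → IsTop r τ d x →
        x ∉ τ ∧ Dominant r (insert x τ) := by
      intro d d' hdd hld htop
      refine ⟨fun hx => ?_, fun y => ?_⟩
      · obtain ⟨i, hi, hix⟩ : ∃ i, i ≠ d ∧ l i = x := by
          obtain ⟨i, hi⟩ := hτ.exists_lowest_eq hr hl hx
          by_cases hid : i = d
          · exact ⟨d', hdd.symm, by rw [← hld, ← hid, hi]⟩
          · exact ⟨i, hid, hi⟩
        obtain ⟨z, hz, hlt⟩ := htop.1 i hi
        rw [← hix] at hlt
        exact absurd ((hl i).2 z hz) (not_le.2 hlt)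
      -- If `y` beats `τ` off `d`, only `d` can witness dominance of `τ` against `y`, and there `x`
      -- is at least as high as `y`. Otherwise `y` is below all of `τ` in another ranking, hence
      -- also below `x`, which beats `τ` there.
      · by_cases hy : Beats r τ d y
        · obtain ⟨i, hi⟩ := hτ y
          have hid : i = d := by
            by_contra hid
            obtain ⟨z, hz, hlt⟩ := hy i hid
            exact absurd (hi z hz) (not_le.2 hlt)
          subst hid
          refine ⟨i, fun z hz => ?_⟩
          rcases Finset.mem_insert.1 hz with rfl | hz
          · exact htop.2 y hy
          · exact hi z hz
        · simp only [Beats, not_forall, not_exists, not_and, not_lt] at hy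
          obtain ⟨i, hid, hi⟩ := hy
          refine ⟨i, fun z hz => ?_⟩
          rcases Finset.mem_insert.1 hz with rfl | hz
          · obtain ⟨w, hw, hlt⟩ := htop.1 i hid
            exact (hi w hw).trans hlt.le
          · exact hi z hz
    rintro (h | h)
    · exact key d₁ d₂ hne12 heq h
    · exact key d₂ d₁ hne12.symm heq.symm h

/-- If for every `d` some point beats `τ` in all rankings other than `d`, there are exactly two
completions. -/
lemma card_completions [Fintype I] [Fintype Y] [DecidableEq Y] {r : I → Y → ℕ}
    (hr : ∀ i, Function.Injective (r i)) {τ : Finset Y} (hne : τ.Nonempty) (hτ : Dominant r τ)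
    (hcard : τ.card + 1 = Fintype.card I) (hb : ∀ d, ∃ y, Beats r τ d y)
    [DecidablePred fun x => x ∉ τ ∧ Dominant r (insert x τ)] :
    (Finset.univ.filter fun x => x ∉ τ ∧ Dominant r (insert x τ)).card = 2 := by
  obtain ⟨d₁, d₂, hd, h⟩ := exists_completions hr hne hτ hcard
  obtain ⟨x₁, h₁⟩ := exists_isTop (hb d₁)
  obtain ⟨x₂, h₂⟩ := exists_isTop (hb d₂)
  rw [Finset.card_eq_two]
  refine ⟨x₁, x₂, fun heq => ?_, ?_⟩
  -- A common top point would beat `τ` in every ranking, against dominance.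
  · obtain ⟨i, hi⟩ := hτ x₁
    by_cases hid : i = d₁
    · obtain ⟨z, hz, hlt⟩ := h₂.1 i (hid ▸ hd)
      rw [← heq] at hlt
      exact absurd (hi z hz) (not_le.2 hlt)
    · obtain ⟨z, hz, hlt⟩ := h₁.1 i hid
      exact absurd (hi z hz) (not_le.2 hlt)
  · ext x
    simp only [Finset.mem_filter, Finset.mem_univ, true_and, h, Finset.mem_insert,
      Finset.mem_singleton]
    constructor
    · rintro (hx | hx)
      · exact Or.inl (hx.unique hr h₁)
      · exact Or.inr (hx.unique hr h₂)
    · rintro (rfl | rfl)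
      · exact Or.inl h₁
      · exact Or.inr h₂

/-- A coloured set that misses at least one colour has zero or two facets carrying all
colours other than `i₀`. -/
lemma even_card_facets [Fintype I] [DecidableEq I] [DecidableEq Y] (c : Y → I) (i₀ : I)
    {σ : Finset Y} (hcard : σ.card = Fintype.card I) (hσ : σ.image c ≠ Finset.univ) :
    Even (σ.filter fun x => (σ.erase x).image c = Finset.univ.erase i₀).card := by
  by_cases hex : ∃ x ∈ σ, (σ.erase x).image c = Finset.univ.erase i₀
  swap
  · rw [Finset.filter_eq_empty_iff.2 fun x hx h => hex ⟨x, hx, h⟩]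
    simp
  obtain ⟨x, hx, himg⟩ := hex
  have hinj : ∀ z ∈ σ, (σ.erase z).image c = Finset.univ.erase i₀ →
      Set.InjOn c (σ.erase z : Finset Y) := by
    intro z hz h
    rw [← Finset.card_image_iff, h, Finset.card_erase_of_mem hz,
      Finset.card_erase_of_mem (Finset.mem_univ _), Finset.card_univ, hcard]
  have hcx : c x ≠ i₀ := by
    intro h
    apply hσ
    rw [← Finset.insert_erase hx, Finset.image_insert, himg, h,
      Finset.insert_erase (Finset.mem_univ _)]
  -- The colour of `x` still occurs in the facet, and colours there are distinct; so `x` shares its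
  -- colour with one other point `x'`, and the facets sought omit `x` or `x'`.
  obtain ⟨x', hx', hcx'⟩ : ∃ x' ∈ σ.erase x, c x' = c x := by
    rw [← Finset.mem_image, himg]; simpa using hcx
  have hxx' : x' ≠ x := (Finset.mem_erase.1 hx').1
  have hx'σ : x' ∈ σ := (Finset.mem_erase.1 hx').2
  suffices h : (σ.filter fun x => (σ.erase x).image c = Finset.univ.erase i₀) = {x, x'} by
    rw [h, Finset.card_pair hxx'.symm]; simp
  ext z
  simp only [Finset.mem_filter, Finset.mem_insert, Finset.mem_singleton]
  constructor
  · rintro ⟨hz, h⟩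
    by_contra hne
    push Not at hne
    exact hxx' (hinj z hz h (by simpa using ⟨hx'σ, hne.2.symm⟩)
      (by simpa using ⟨hx, hne.1.symm⟩) hcx')
  · rintro (rfl | rfl)
    · exact ⟨hx, himg⟩
    · refine ⟨hx'σ, ?_⟩
      rw [← himg]
      ext i
      simp only [Finset.mem_image, Finset.mem_erase]
      constructor
      · rintro ⟨w, ⟨hw, hwσ⟩, rfl⟩
        by_cases hwx : w = x
        · exact ⟨z, ⟨hxx', hx'σ⟩, by rw [hcx', hwx]⟩
        · exact ⟨w, ⟨hwx, hwσ⟩, rfl⟩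
      · rintro ⟨w, ⟨hw, hwσ⟩, rfl⟩
        by_cases hwx : w = z
        · exact ⟨x, ⟨hxx'.symm, hx⟩, by rw [← hcx', hwx]⟩
        · exact ⟨w, ⟨hwx, hwσ⟩, rfl⟩

end Cells

end Scarf

namespace Scarf

/-! ### Boundary dummies and Scarf's lemma -/

section Dummies

variable {I X : Type*} [Fintype I] [DecidableEq I]

/-- The rankings extended to one dummy point per index: the dummy `k` is the lowest point in the
ranking `k` and lies above all points of `X` in the other rankings. -/
noncomputable def extendedRank (ρ : I → X → ℕ) (B : ℕ) (i : I) : X ⊕ I → ℕ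
  | Sum.inl x => 1 + ρ i x
  | Sum.inr k => if k = i then 0 else 1 + B + Fintype.equivFin I k

lemma extendedRank_injective {ρ : I → X → ℕ} (hρ : ∀ i, Function.Injective (ρ i)) {B : ℕ}
    (hB : ∀ i x, ρ i x < B) (i : I) : Function.Injective (extendedRank ρ B i) := by
  rintro (x | k) (x' | k') h <;> simp only [extendedRank] at h
  · exact congrArg _ (hρ i (by omega))
  · have := hB i x
    split_ifs at h <;> omega
  · have := hB i x'
    split_ifs at h <;> omega
  · split_ifs at h with h1 h2 h2
    · rw [h1, h2]
    · omega
    · omega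
    · congr 1
      apply (Fintype.equivFin I).injective
      ext
      omega

/-- For a facet that contains a point of `X` this supplies the last hypothesis of
`card_completions`. -/
lemma beats_dummy {ρ : I → X → ℕ} {B : ℕ} (hB : ∀ i x, ρ i x < B) {τ : Finset (X ⊕ I)} {x : X}
    (hx : Sum.inl x ∈ τ) (d : I) : Beats (extendedRank ρ B) τ d (Sum.inr d) := by
  intro i hi
  refine ⟨_, hx, ?_⟩
  have := hB i x
  simp only [extendedRank, if_neg hi.symm]
  omega

/-- The boundary facet, which consists of all dummies but one, has exactly one completion. -/
lemma card_completions_dummies [Fintype X] [DecidableEq X] [Nonempty X] {ρ : I → X → ℕ}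
    (hρ : ∀ i, Function.Injective (ρ i)) {B : ℕ} (hB : ∀ i x, ρ i x < B) {i₀ : I}
    {τ : Finset (X ⊕ I)} (hinl : ∀ x, Sum.inl x ∉ τ) (hinr : ∀ i, Sum.inr i ∈ τ ↔ i ≠ i₀)
    [DecidablePred fun x => x ∉ τ ∧ Dominant (extendedRank ρ B) (insert x τ)] :
    (Finset.univ.filter fun x =>
      x ∉ τ ∧ Dominant (extendedRank ρ B) (insert x τ)).card = 1 := by
  -- The completion is the `i₀`-highest point of `X`. The missing dummy is no completion: in each
  -- ranking the ranking's own dummy lies below all of `X`, so the set of all dummies is not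
  -- dominant.
  obtain ⟨t, -, ht⟩ := Finset.exists_max_image (Finset.univ : Finset X) (ρ i₀)
    Finset.univ_nonempty
  rw [Finset.card_eq_one]
  refine ⟨Sum.inl t, ?_⟩
  ext x
  simp only [Finset.mem_filter, Finset.mem_univ, true_and, Finset.mem_singleton]
  have hlow : ∀ (i : I) (y : X), ¬ extendedRank ρ B i (Sum.inl y) ≤
      extendedRank ρ B i (Sum.inr i) := by
    intro i y; simp [extendedRank]
  constructor
  · rintro ⟨hx, hdom⟩
    rcases x with x | k
    · congr 1
      obtain ⟨i, hi⟩ := hdom (Sum.inl t)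
      by_cases hii : i = i₀
      · subst hii
        have h := hi _ (Finset.mem_insert_self _ _)
        simp only [extendedRank] at h
        exact hρ i (le_antisymm (ht x (Finset.mem_univ _)) (by omega))
      · exact absurd (hi _ (Finset.mem_insert_of_mem ((hinr i).2 hii))) (hlow i t)
    · obtain ⟨i, hi⟩ := hdom (Sum.inl t)
      have hk : k = i₀ := by
        by_contra h; exact hx ((hinr k).2 h)
      have hmem : Sum.inr i ∈ insert (Sum.inr k) τ := by
        by_cases hii : i = i₀
        · rw [hii, hk]; exact Finset.mem_insert_self _ _
        · exact Finset.mem_insert_of_mem ((hinr i).2 hii)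
      exact absurd (hi _ hmem) (hlow i t)
  · rintro rfl
    refine ⟨hinl t, ?_⟩
    rintro (y | k)
    · refine ⟨i₀, fun z hz => ?_⟩
      rcases Finset.mem_insert.1 hz with rfl | hz
      · simpa [extendedRank] using ht y (Finset.mem_univ _)
      · rcases z with z | j
        · exact absurd hz (hinl z)
        · have := hB i₀ y
          simp only [extendedRank, if_neg ((hinr j).1 hz)]
          omega
    · exact ⟨k, fun z _ => by simp [extendedRank]⟩

/-- Scarf's lemma: for finitely many rankings of a finite set and any colouring of its points by
the rankings there is a set of points that is dominant for a set `C` of rankings and carries all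
colours of `C`. -/
theorem exists_dominant_colored [Finite X] [Nonempty X] [Nonempty I] {ρ : I → X → ℕ}
    (hρ : ∀ i, Function.Injective (ρ i)) (c : X → I) :
    ∃ (σ : Finset X) (C : Finset I), (∀ y, ∃ i ∈ C, ∀ x ∈ σ, ρ i y ≤ ρ i x) ∧
      ∀ i ∈ C, ∃ x ∈ σ, c x = i := by
  classical
  have := Fintype.ofFinite X
  obtain ⟨B, hB⟩ : ∃ B, ∀ i x, ρ i x < B := by
    obtain ⟨B, hB⟩ := (Set.finite_range fun q : I × X => ρ q.1 q.2).bddAbove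
    exact ⟨B + 1, fun i x => Nat.lt_succ_of_le (hB ⟨(i, x), rfl⟩)⟩
  set r := extendedRank ρ B with hr_def
  have hr : ∀ i, Function.Injective (r i) := extendedRank_injective hρ hB
  set c' : X ⊕ I → I := Sum.elim c id with hc'
  let i₀ : I := Classical.arbitrary I
  let rooms : Finset (Finset (X ⊕ I)) :=
    Finset.univ.filter fun σ => σ.card = Fintype.card I ∧ Dominant r σ
  let doors : Finset (Finset (X ⊕ I)) := Finset.univ.filter fun τ =>
    τ.card + 1 = Fintype.card I ∧ Dominant r τ ∧ τ.image c' = Finset.univ.erase i₀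
  have hpos : 0 < Fintype.card I := Fintype.card_pos
  have hfull : ∃ σ ∈ rooms, σ.image c' = Finset.univ := by
    by_contra! hno
    -- Incidences between doors and rooms are counted in two ways. Without a fully coloured room,
    -- every room has an even number of doors; every door lies in two rooms, except `τ₀`, which lies
    -- in one. The parities disagree.
    have hcount := Finset.sum_card_bipartiteAbove_eq_sum_card_bipartiteBelow (s := doors)
      (t := rooms) (fun τ σ => τ ⊆ σ)
    have hroom : ∀ σ ∈ rooms,
        Even (Finset.bipartiteBelow (fun τ σ => τ ⊆ σ) doors σ).card := by
      intro σ hσ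
      have hσ' : σ.card = Fintype.card I ∧ Dominant r σ := by simpa [rooms] using hσ
      have := even_card_facets c' i₀ hσ'.1 (hno σ hσ)
      convert this using 1
      symm
      refine Finset.card_bij (fun x _ => σ.erase x) ?_ ?_ ?_
      · intro x hx
        obtain ⟨hxσ, himg⟩ := Finset.mem_filter.1 hx
        refine Finset.mem_filter.2 ⟨Finset.mem_filter.2 ⟨Finset.mem_univ _, ?_,
          hσ'.2.mono (Finset.erase_subset _ _), himg⟩, Finset.erase_subset _ _⟩
        rw [Finset.card_erase_of_mem hxσ]; omega
      · intro x hx x' _ h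
        by_contra hne
        have : x ∈ σ.erase x' := Finset.mem_erase.2 ⟨hne, (Finset.mem_filter.1 hx).1⟩
        rw [← h] at this
        exact Finset.notMem_erase _ _ this
      · intro τ hτ
        obtain ⟨hτd, hτσ⟩ := Finset.mem_filter.1 hτ
        obtain ⟨-, hcard, hdom, himg⟩ := Finset.mem_filter.1 hτd
        have h1 : (σ \ τ).card = 1 := by rw [Finset.card_sdiff_of_subset hτσ]; omega
        obtain ⟨x, hx⟩ := Finset.card_eq_one.1 h1
        have hxσ : x ∈ σ := (Finset.mem_sdiff.1 (hx ▸ Finset.mem_singleton_self x)).1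
        have hτx : σ.erase x = τ := by
          rw [← Finset.sdiff_singleton_eq_erase, ← hx, Finset.sdiff_sdiff_eq_self hτσ]
        exact ⟨x, Finset.mem_filter.2 ⟨hxσ, by rw [hτx, himg]⟩, hτx⟩
    have hdoor : ∀ τ ∈ doors, (Finset.bipartiteAbove (fun τ σ => τ ⊆ σ) rooms τ).card =
        (Finset.univ.filter fun x => x ∉ τ ∧ Dominant r (insert x τ)).card := by
      intro τ hτ
      obtain ⟨-, hcard, hdom, himg⟩ := Finset.mem_filter.1 hτ
      symm
      refine Finset.card_bij (fun x _ => insert x τ) ?_ ?_ ?_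
      · intro x hx
        obtain ⟨-, hxτ, hd⟩ := Finset.mem_filter.1 hx
        refine Finset.mem_filter.2 ⟨Finset.mem_filter.2 ⟨Finset.mem_univ _, ?_, hd⟩,
          Finset.subset_insert _ _⟩
        rw [Finset.card_insert_of_notMem hxτ, hcard]
      · intro x hx x' _ h
        obtain ⟨-, hxτ, -⟩ := Finset.mem_filter.1 hx
        have : x ∈ insert x' τ := h ▸ Finset.mem_insert_self x τ
        exact (Finset.mem_insert.1 this).resolve_right hxτ
      · intro σ hσ
        obtain ⟨hσr, hτσ⟩ := Finset.mem_filter.1 hσ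
        obtain ⟨-, hσc, hd⟩ := Finset.mem_filter.1 hσr
        have h1 : (σ \ τ).card = 1 := by rw [Finset.card_sdiff_of_subset hτσ]; omega
        obtain ⟨x, hx⟩ := Finset.card_eq_one.1 h1
        have hxs := Finset.mem_sdiff.1 (hx ▸ Finset.mem_singleton_self x : x ∈ σ \ τ)
        have hins : insert x τ = σ := by
          rw [Finset.insert_eq, ← hx, Finset.sdiff_union_of_subset hτσ]
        exact ⟨x, Finset.mem_filter.2 ⟨Finset.mem_univ _, hxs.2, by rwa [hins]⟩, hins⟩
    let τ₀ : Finset (X ⊕ I) := (Finset.univ.erase i₀).map Function.Embedding.inr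
    have hinl : ∀ x, Sum.inl x ∉ τ₀ := by simp [τ₀]
    have hinr : ∀ i, Sum.inr i ∈ τ₀ ↔ i ≠ i₀ := by simp [τ₀]
    have hone := card_completions_dummies (τ := τ₀) hρ hB hinl hinr
    have hτ₀ : τ₀ ∈ doors := by
      obtain ⟨x, hx⟩ := Finset.card_eq_one.1 hone
      have hx' := Finset.mem_filter.1 (hx ▸ Finset.mem_singleton_self x)
      refine Finset.mem_filter.2 ⟨Finset.mem_univ _, ?_,
        hx'.2.2.mono (Finset.subset_insert _ _), ?_⟩
      · simp only [τ₀, Finset.card_map, Finset.card_erase_of_mem (Finset.mem_univ i₀),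
          Finset.card_univ]
        omega
      · ext i
        simp [τ₀, hc']
    have htwo : ∀ τ ∈ doors, τ ≠ τ₀ →
        (Finset.univ.filter fun x => x ∉ τ ∧ Dominant r (insert x τ)).card = 2 := by
      intro τ hτ hne
      obtain ⟨-, hcard, hdom, himg⟩ := Finset.mem_filter.1 hτ
      obtain ⟨x, hx⟩ : ∃ x, Sum.inl x ∈ τ := by
        by_contra! hall
        apply hne
        ext z
        rcases z with x | i
        · simp [hall x, hinl x]
        · rw [hinr]
          have h2 : i ∈ τ.image c' ↔ i ≠ i₀ := by rw [himg]; simp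
          rw [← h2, Finset.mem_image]
          constructor
          · exact fun h => ⟨_, h, rfl⟩
          · rintro ⟨x | k, hz, hzi⟩
            · exact absurd hz (hall x)
            · simp only [hc', Sum.elim_inr, id] at hzi
              rwa [← hzi]
      exact card_completions hr ⟨_, hx⟩ hdom hcard fun d => ⟨_, beats_dummy hB hx d⟩
    rw [← Finset.add_sum_erase _ _ hτ₀, hdoor _ hτ₀, hone] at hcount
    have e1 : Even (∑ σ ∈ rooms, (Finset.bipartiteBelow (fun τ σ => τ ⊆ σ) doors σ).card) :=
      Finset.even_sum _ hroom
    have e2 : Even (∑ τ ∈ doors.erase τ₀,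
        (Finset.bipartiteAbove (fun τ σ => τ ⊆ σ) rooms τ).card) := by
      refine Finset.even_sum _ fun τ hτ => ?_
      obtain ⟨hne, hτd⟩ := Finset.mem_erase.1 hτ
      rw [hdoor τ hτd, htwo τ hτd hne]
      exact even_two
    rw [← hcount, add_comm] at e1
    exact (Nat.not_even_iff_odd.2 e2.add_one) e1
  obtain ⟨σ, hσ, himg⟩ := hfull
  obtain ⟨-, -, hdom⟩ := Finset.mem_filter.1 hσ
  -- `C` consists of the indices whose dummy is absent. A ranking with its dummy in `σ` never
  -- witnesses dominance against a point of `X`, and the colour of an absent dummy must be carried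
  -- by a point of `X`.
  refine ⟨Finset.univ.filter fun x => Sum.inl x ∈ σ,
    Finset.univ.filter fun i => Sum.inr i ∉ σ, fun y => ?_, fun i hi => ?_⟩
  · obtain ⟨i, hi⟩ := hdom (Sum.inl y)
    refine ⟨i, ?_, fun x hx => ?_⟩
    · simp only [Finset.mem_filter, Finset.mem_univ, true_and]
      intro h
      have := hi _ h
      simp [hr_def, extendedRank] at this
    · have := hi (Sum.inl x) (by simpa using hx)
      simpa [hr_def, extendedRank] using this
  · obtain ⟨z, hz, hzi⟩ := Finset.mem_image.1 (himg ▸ Finset.mem_univ i)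
    rcases z with x | k
    · exact ⟨x, by simpa using hz, hzi⟩
    · simp only [hc', Sum.elim_inr, id] at hzi
      subst hzi
      simp [hz] at hi

end Dummies

end Scarf

/-! ### The theorems of Brouwer and Kakutani -/

section FixedPoints

/-- A colouring of the grid points of a simplex by its coordinates has a cluster of nearby points
that carries the colours of all coordinates that are not small there. -/
theorem exists_grid_cluster {I : Type*} [Fintype I] [Nonempty I] (N : ℕ)
    (c : {x : I → ℕ // ∑ i, x i = N} → I) :
    ∃ x₀ : {x : I → ℕ // ∑ i, x i = N}, ∀ i, x₀.1 i ≤ Fintype.card I ∨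
      ∃ x, c x = i ∧ ∀ k, x.1 k ≤ x₀.1 k + Fintype.card I ∧ x₀.1 k ≤ x.1 k + Fintype.card I := by
  classical
  have hfin : Finite {x : I → ℕ // ∑ i, x i = N} := by
    refine Set.Finite.to_subtype ((Finset.piAntidiag Finset.univ N).finite_toSet.subset ?_)
    intro x hx
    simpa using (show ∑ i, x i = N from hx)
  have := Fintype.ofFinite {x : I → ℕ // ∑ i, x i = N}
  have hne : Nonempty {x : I → ℕ // ∑ i, x i = N} :=
    ⟨⟨Pi.single (Classical.arbitrary I) N, by simp⟩⟩
  let e := Fintype.equivFin {x : I → ℕ // ∑ i, x i = N}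
  let K := Fintype.card {x : I → ℕ // ∑ i, x i = N}
  -- Points are ranked by the `i`-th coordinate, with ties broken by an enumeration.
  let ρ : I → {x : I → ℕ // ∑ i, x i = N} → ℕ := fun i x => x.1 i * K + e x
  have hρlt : ∀ i x y, x.1 i < y.1 i → ρ i x < ρ i y := by
    intro i x y h
    have h1 := (e x).2
    have h2 : (x.1 i + 1) * K ≤ y.1 i * K := Nat.mul_le_mul_right _ h
    simp only [ρ]
    change (e x : ℕ) < K at h1
    nlinarith
  have hρ : ∀ i, Function.Injective (ρ i) := by
    intro i x y h
    rcases lt_trichotomy (x.1 i) (y.1 i) with hlt | heq | hlt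
    · exact absurd h (hρlt i x y hlt).ne
    · apply e.injective
      ext
      simp only [ρ, heq] at h
      omega
    · exact absurd h (hρlt i y x hlt).ne'
  obtain ⟨σ, C, hdom, hcol⟩ := Scarf.exists_dominant_colored hρ c
  have hC : C.Nonempty := by
    obtain ⟨i, hi, -⟩ := hdom (Classical.arbitrary _)
    exact ⟨i, hi⟩
  have hσ : σ.Nonempty := by
    obtain ⟨i, hi⟩ := hC
    obtain ⟨x, hx, -⟩ := hcol i hi
    exact ⟨x, hx⟩
  choose l hl using fun i : I => Finset.exists_min_image σ (fun x => x.1 i) hσ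
  -- If the coordinate minima over `σ`, each raised by 1, fitted into the total `N`, a grid point
  -- with at least these coordinates would defeat dominance. So the minima over `C` sum to more than
  -- `N - C.card`, which bounds both the spread of `σ` in `C` and the coordinates outside `C`.
  have hsum : N < ∑ i ∈ C, ((l i).1 i + 1) := by
    by_contra! hle
    obtain ⟨i₁, hi₁⟩ := hC
    set s := ∑ i ∈ C, ((l i).1 i + 1) with hs
    let y : I → ℕ := fun i => (if i ∈ C then (l i).1 i + 1 else 0) + if i = i₁ then N - s else 0
    have hy : ∑ i, y i = N := by
      simp only [y, Finset.sum_add_distrib, Finset.sum_ite_eq', Finset.mem_univ, if_true]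
      rw [Finset.sum_ite_mem, Finset.univ_inter, ← hs]
      omega
    obtain ⟨i, hi, hle⟩ := hdom ⟨y, hy⟩
    have h1 := hle (l i) (hl i).1
    have h2 := hρlt i (l i) ⟨y, hy⟩ (by simp only [y, if_pos hi]; omega)
    omega
  have hlow : ∀ x ∈ σ, ∀ i ∈ C, (l i).1 i ≤ x.1 i := fun x hx i _ => (hl i).2 x hx
  have hcardC : C.card ≤ Fintype.card I := Finset.card_le_univ C
  have hsum' : N < ∑ i ∈ C, (l i).1 i + C.card := by
    simpa [Finset.sum_add_distrib] using hsum
  have hin : ∀ x ∈ σ, ∀ k ∈ C, x.1 k ≤ (l k).1 k + Fintype.card I := by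
    intro x hx k hk
    have h1 : ∑ i ∈ C, x.1 i ≤ N := 
      (Finset.sum_le_sum_of_subset (Finset.subset_univ _)).trans x.2.le
    have h2 : ∑ i ∈ C.erase k, (l i).1 i ≤ ∑ i ∈ C.erase k, x.1 i :=
      Finset.sum_le_sum fun i hi => hlow x hx i (Finset.mem_of_mem_erase hi)
    rw [← Finset.add_sum_erase _ _ hk] at h1 hsum'
    omega
  have hout : ∀ x ∈ σ, ∀ k, k ∉ C → x.1 k ≤ Fintype.card I := by
    intro x hx k hk
    have h1 : ∑ i ∈ insert k C, x.1 i ≤ N := 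
      (Finset.sum_le_sum_of_subset (Finset.subset_univ _)).trans x.2.le
    have h2 : ∑ i ∈ C, (l i).1 i ≤ ∑ i ∈ C, x.1 i :=
      Finset.sum_le_sum fun i hi => hlow x hx i hi
    rw [Finset.sum_insert hk] at h1
    omega
  obtain ⟨x₀, hx₀⟩ := hσ
  refine ⟨x₀, fun i => ?_⟩
  by_cases hi : i ∈ C
  · obtain ⟨x, hx, hxi⟩ := hcol i hi
    refine Or.inr ⟨x, hxi, fun k => ?_⟩
    by_cases hk : k ∈ C
    · have := hin x hx k hk
      have := hin x₀ hx₀ k hk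
      have := hlow x hx k hk
      have := hlow x₀ hx₀ k hk
      omega
    · have := hout x hx k hk
      have := hout x₀ hx₀ k hk
      omega
  · exact Or.inl (hout x₀ hx₀ i hi)

/-- **Brouwer's fixed point theorem** for simplices. -/
theorem exists_fixedPoint_stdSimplex {I : Type*} [Fintype I] [Nonempty I]
    {f : (I → ℝ) → I → ℝ} (hf : ContinuousOn f (stdSimplex ℝ I))
    (hmaps : Set.MapsTo f (stdSimplex ℝ I) (stdSimplex ℝ I)) :
    ∃ x ∈ stdSimplex ℝ I, f x = x := by
  classical
  have hcpt : IsCompact (stdSimplex ℝ I) := isCompact_stdSimplex ℝ I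
  have happrox : ∀ ε > 0, ∃ x ∈ stdSimplex ℝ I, ∀ i, x i - ε ≤ f x i := by
    intro ε hε
    obtain ⟨δ, hδ, hunif⟩ := Metric.uniformContinuousOn_iff.1
      (hcpt.uniformContinuousOn_of_continuous hf) (ε / 2) (half_pos hε)
    set n : ℝ := (Fintype.card I : ℝ) with hn
    have hn0 : 0 ≤ n := Nat.cast_nonneg _
    obtain ⟨N, hN⟩ := exists_nat_gt (max (n / (δ / 2)) (n / (ε / 2)))
    have hN0 : (0 : ℝ) < N := lt_of_le_of_lt (le_max_of_le_left (by positivity)) hN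
    have hNδ : n / N ≤ δ / 2 := by
      rw [div_le_iff₀ hN0, mul_comm, ← div_le_iff₀ (by positivity)]
      exact (le_max_left _ _).trans hN.le
    have hNε : n / N ≤ ε / 2 := by
      rw [div_le_iff₀ hN0, mul_comm, ← div_le_iff₀ (by positivity)]
      exact (le_max_right _ _).trans hN.le
    let pt : {x : I → ℕ // ∑ i, x i = N} → I → ℝ := fun x i => x.1 i / N
    have hpt : ∀ x, pt x ∈ stdSimplex ℝ I := by
      intro x
      refine ⟨fun i => by positivity, ?_⟩
      simp only [pt]
      rw [← Finset.sum_div, ← Nat.cast_sum, x.2, div_self hN0.ne']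
    -- A point and its image have equal sums, so some coordinate does not decrease; it serves as the
    -- colour.
    have hcol : ∀ x, ∃ i, pt x i ≤ f (pt x) i := by
      intro x
      by_contra! hlt
      have h1 := (hmaps (hpt x)).2
      have h2 := (hpt x).2
      have h3 : ∑ i, f (pt x) i < ∑ i, pt x i :=
        Finset.sum_lt_sum_of_nonempty Finset.univ_nonempty fun i _ => hlt i
      linarith
    choose c hc using hcol
    obtain ⟨x₀, hx₀⟩ := exists_grid_cluster N c
    refine ⟨pt x₀, hpt x₀, fun i => ?_⟩
    rcases hx₀ i with h | ⟨x, hxi, hx⟩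
    · have h1 : pt x₀ i ≤ n / N := by
        simp only [pt]; gcongr; rw [hn]; exact_mod_cast h
      have h2 := (hmaps (hpt x₀)).1 i
      linarith
    · have hclose : ∀ k, |pt x k - pt x₀ k| ≤ n / N := by
        intro k
        have h1 : (x.1 k : ℝ) ≤ x₀.1 k + n := by rw [hn]; exact_mod_cast (hx k).1
        have h2 : (x₀.1 k : ℝ) ≤ x.1 k + n := by rw [hn]; exact_mod_cast (hx k).2
        simp only [pt]
        rw [← sub_div, abs_div, abs_of_pos hN0]
        gcongr
        rw [abs_le]; constructor <;> linarith
      have hdist : dist (pt x) (pt x₀) < δ := by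
        refine lt_of_le_of_lt ((dist_pi_le_iff (by positivity)).2 fun k => ?_)
          (half_lt_self hδ)
        rw [Real.dist_eq]
        exact (hclose k).trans hNδ
      have h1 := (dist_le_pi_dist (f (pt x)) (f (pt x₀)) i).trans_lt
        (hunif _ (hpt x) _ (hpt x₀) hdist)
      rw [Real.dist_eq, abs_lt] at h1
      have h2 := abs_le.1 (hclose i)
      have h3 := hc x
      rw [hxi] at h3
      linarith
  have hne : (stdSimplex ℝ I).Nonempty := by
    obtain ⟨x, hx, -⟩ := happrox 1 one_pos
    exact ⟨x, hx⟩
  -- Approximate fixed points make the maximum of this function nonnegative. At a maximizer no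
  -- coordinate decreases, and equal sums force equality.
  have hcont : ContinuousOn (fun x => Finset.univ.inf' Finset.univ_nonempty fun i => f x i - x i)
      (stdSimplex ℝ I) := by
    refine ContinuousOn.finset_inf'_apply _ fun i _ => ?_
    exact ((continuous_apply i).comp_continuousOn hf).sub (continuous_apply i).continuousOn
  obtain ⟨x, hx, hmax⟩ := hcpt.exists_isMaxOn hne hcont
  have hge : ∀ i, x i ≤ f x i := by
    intro i
    refine le_of_forall_pos_le_add fun ε hε => ?_
    obtain ⟨z, hz, hzε⟩ := happrox ε hε
    have h1 : -ε ≤ Finset.univ.inf' Finset.univ_nonempty fun i => f z i - z i := by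
      rw [Finset.le_inf'_iff]
      intro i _
      linarith [hzε i]
    have h2 := h1.trans (hmax hz)
    have h3 := Finset.inf'_le (fun i => f x i - x i) (Finset.mem_univ i)
    simp only at h2
    linarith
  refine ⟨x, hx, ?_⟩
  have hs : ∑ i, (f x i - x i) = 0 := by
    rw [Finset.sum_sub_distrib, (hmaps hx).2, hx.2, sub_self]
  have h0 := (Finset.sum_eq_zero_iff_of_nonneg fun i _ => sub_nonneg.2 (hge i)).1 hs
  ext i
  linarith [h0 i (Finset.mem_univ i)]

/-- A set-valued map of a compact convex set has points that are convex combinations of values at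
nearby points. -/
lemma exists_mem_convexHull_nearby {E : Type*} [NormedAddCommGroup E] [NormedSpace ℝ E]
    {K : Set E} (hK : IsCompact K) (hKc : Convex ℝ K) (hKne : K.Nonempty) {F : E → Set E}
    (hsub : ∀ x ∈ K, F x ⊆ K) (hne : ∀ x ∈ K, (F x).Nonempty) {ε : ℝ} (hε : 0 < ε) :
    ∃ x ∈ K, x ∈ convexHull ℝ {y | ∃ a ∈ K, dist a x < ε ∧ y ∈ F a} := by
  classical
  obtain ⟨t, htK, htfin, hcover⟩ := hK.finite_cover_balls hε
  have := htfin.fintype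
  have hcov : ∀ x ∈ K, ∃ a : t, dist x a < ε := by
    intro x hx
    obtain ⟨a, ha, hxa⟩ := Set.mem_iUnion₂.1 (hcover hx)
    exact ⟨⟨a, ha⟩, hxa⟩
  have htne : Nonempty t := by
    obtain ⟨x, hx⟩ := hKne
    exact ⟨(hcov x hx).choose⟩
  choose y hy using fun a : t => hne a (htK a.2)
  let φ : t → E → ℝ := fun a x => max 0 (ε - dist x a)
  have hφ0 : ∀ a x, 0 ≤ φ a x := fun a x => le_max_left _ _
  have hφc : ∀ a, Continuous (φ a) := fun a => by fun_prop
  have hφs : ∀ x ∈ K, 0 < ∑ a, φ a x := by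
    intro x hx
    obtain ⟨a, ha⟩ := hcov x hx
    refine Finset.sum_pos' (fun a _ => hφ0 a x) ⟨a, Finset.mem_univ _, ?_⟩
    exact lt_max_of_lt_right (sub_pos.2 ha)
  -- Brouwer's theorem is applied to the weights rather than to `K`: at a fixed `w`, the weight of
  -- `a` is proportional to `φ a (g w)`, which vanishes unless `a` is within `ε` of `g w`.
  let g : (t → ℝ) → E := fun w => ∑ a, w a • y a
  have hg : Continuous g := by fun_prop
  have hgK : ∀ w ∈ stdSimplex ℝ t, g w ∈ K := fun w hw =>
    hKc.sum_mem (fun a _ => hw.1 a) hw.2 fun a _ => hsub _ (htK a.2) (hy a)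
  obtain ⟨w, hw, hfix⟩ := exists_fixedPoint_stdSimplex
    (f := fun w a => φ a (g w) / ∑ b, φ b (g w))
    (by
      refine continuousOn_pi.2 fun a => ContinuousOn.div ?_ ?_ ?_
      · exact ((hφc a).comp hg).continuousOn
      · exact (continuous_finsetSum _ fun b _ => (hφc b).comp hg).continuousOn
      · exact fun w hw => (hφs _ (hgK w hw)).ne')
    (by
      intro w hw
      refine ⟨fun a => div_nonneg (hφ0 _ _) (hφs _ (hgK w hw)).le, ?_⟩
      rw [← Finset.sum_div, div_self (hφs _ (hgK w hw)).ne'])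
  refine ⟨g w, hgK w hw, ?_⟩
  have hpos : ∀ a, w a ≠ 0 → dist (a : E) (g w) < ε := by
    intro a ha
    by_contra! hle
    apply ha
    rw [← hfix]
    have : φ a (g w) = 0 := by
      simp only [φ]
      rw [dist_comm]
      exact max_eq_left (by linarith)
    simp [this]
  have hgw : g w = ∑ a with w a ≠ 0, w a • y a := by
    rw [Finset.sum_filter_of_ne]
    intro a _ h h0
    exact h (by rw [h0, zero_smul])
  rw [hgw]
  refine (convex_convexHull ℝ _).sum_mem (fun a _ => hw.1 a) ?_ fun a ha => ?_
  · rw [Finset.sum_filter_ne_zero, hw.2]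
  · exact subset_convexHull ℝ _
      ⟨a, htK a.2, hgw ▸ hpos a (Finset.mem_filter.1 ha).2, hy a⟩

/-- **Kakutani's fixed point theorem** in normed spaces. -/
theorem exists_mem_self_of_isClosed_graph {E : Type*} [NormedAddCommGroup E] [NormedSpace ℝ E]
    {K : Set E} (hK : IsCompact K) (hKc : Convex ℝ K) (hKne : K.Nonempty) {F : E → Set E}
    (hsub : ∀ x ∈ K, F x ⊆ K) (hne : ∀ x ∈ K, (F x).Nonempty)
    (hconv : ∀ x ∈ K, Convex ℝ (F x))
    (hclosed : IsClosed {q : E × E | q.1 ∈ K ∧ q.2 ∈ F q.1}) : ∃ x ∈ K, x ∈ F x := by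
  set G := {q : E × E | q.1 ∈ K ∧ q.2 ∈ F q.1} with hG
  have hGK : G ⊆ K ×ˢ K := fun q hq => ⟨hq.1, hsub _ hq.1 hq.2⟩
  have husc : ∀ x ∈ K, ∀ δ > 0, ∃ η > 0, ∀ a ∈ K, dist a x < η →
      F a ⊆ Metric.thickening δ (F x) := by
    intro x hx δ hδ
    -- The part of the graph with values far from `F x` is compact; its projection is closed and
    -- misses `x`, hence misses a ball around `x`.
    let B : Set (E × E) := G ∩ Prod.snd ⁻¹' (Metric.thickening δ (F x))ᶜ
    have hB : IsClosed (Prod.fst '' B) := by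
      refine IsCompact.isClosed (IsCompact.image ?_ continuous_fst)
      refine (hK.prod hK).of_isClosed_subset ?_ (Set.inter_subset_left.trans hGK)
      exact hclosed.inter (Metric.isOpen_thickening.isClosed_compl.preimage continuous_snd)
    have hxB : x ∉ Prod.fst '' B := by
      rintro ⟨⟨x', v⟩, ⟨hq, hv⟩, rfl⟩
      exact hv (Metric.self_subset_thickening hδ _ hq.2)
    obtain ⟨η, hη, hball⟩ := Metric.isOpen_iff.1 hB.isOpen_compl x hxB
    refine ⟨η, hη, fun a ha hax v hv => ?_⟩
    by_contra hv'
    exact hball hax ⟨(a, v), ⟨⟨ha, hv⟩, hv'⟩, rfl⟩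
  choose x hxK hx using fun n : ℕ =>
    exists_mem_convexHull_nearby hK hKc hKne hsub hne (Nat.one_div_pos_of_nat (α := ℝ) (n := n))
  obtain ⟨z, hz, θ, hθ, hlim⟩ := hK.tendsto_subseq hxK
  refine ⟨z, hz, ?_⟩
  have hFz : IsClosed (F z) := by
    have : F z = (fun v => (z, v)) ⁻¹' G := by
      ext v; simp [hG, hz]
    rw [this]
    exact hclosed.preimage (by fun_prop)
  rw [← hFz.closure_eq, Metric.mem_closure_iff]
  intro δ hδ
  obtain ⟨η, hη, husc'⟩ := husc z hz (δ / 2) (half_pos hδ)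
  have h1 : ∀ᶠ n in Filter.atTop, dist (x (θ n)) z < min (η / 2) (δ / 2) :=
    Metric.tendsto_nhds.1 hlim _ (by positivity)
  have h2 : ∀ᶠ n in Filter.atTop, (1 : ℝ) / ((θ n : ℕ) + 1) < η / 2 :=
    (tendsto_one_div_add_atTop_nhds_zero_nat.comp hθ.tendsto_atTop).eventually_lt_const
      (half_pos hη)
  obtain ⟨n, hn1, hn2⟩ := (h1.and h2).exists
  have hmem : x (θ n) ∈ Metric.thickening (δ / 2) (F z) := by
    -- A thickening of the convex set `F z` is convex, so it contains the convex combination along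
    -- with the nearby values.
    refine convexHull_min ?_ ((hconv z hz).thickening _) (hx (θ n))
    rintro v ⟨a, ha, hda, hv⟩
    refine husc' a ha ?_ hv
    have := dist_triangle a (x (θ n)) z
    have := hn1.trans_le (min_le_left _ _)
    linarith
  obtain ⟨v, hv, hdv⟩ := Metric.mem_thickening_iff.1 hmem
  refine ⟨v, hv, ?_⟩
  have := dist_triangle z (x (θ n)) v
  have := hn1.trans_le (min_le_right _ _)
  rw [dist_comm] at this
  linarith

end FixedPoints

/-! ### Greedy filling, and linear forms on the simplex -/

/-- The greedy choice along a strict total order: filling a quantity `q` from the sources in their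
order uses the smaller of `q` and the total supply. -/
lemma sum_min_max_sub_sum {α : Type*} [Fintype α] (r : α → α → Prop) [IsStrictTotalOrder α r]
    [DecidableRel r] {v : α → ℝ} (hv : ∀ a, 0 ≤ v a) {q : ℝ} (hq : 0 ≤ q) :
    ∑ k, min (v k) (max 0 (q - ∑ k' with r k' k, v k')) = min q (∑ k, v k) := by
  classical
  let _ := linearOrderOfSTO r
  suffices h : ∀ s : Finset α,
      ∑ k ∈ s, min (v k) (max 0 (q - ∑ k' ∈ s with r k' k, v k')) = min q (∑ k ∈ s, v k) from
    h Finset.univ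
  intro s
  -- The added element comes last in the order: it leaves the residuals of the others unchanged and
  -- receives what they leave over.
  induction s using Finset.induction_on_max with
  | empty => simp [hq]
  | insert a s hs ih =>
    have ha : a ∉ s := fun h => lt_irrefl a (hs a h)
    rw [Finset.sum_insert ha, Finset.sum_insert ha]
    have h1 : (insert a s).filter (fun k' => r k' a) = s := by
      ext k
      simp only [Finset.mem_filter, Finset.mem_insert]
      constructor
      · rintro ⟨rfl | hk, hr⟩
        · exact absurd hr (irrefl_of r k)
        · exact hk
      · exact fun hk => ⟨Or.inr hk, hs k hk⟩
    have h2 : ∀ k ∈ s, (insert a s).filter (fun k' => r k' k) = s.filter fun k' => r k' k := by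
      intro k hk
      rw [Finset.filter_insert, if_neg]
      exact fun h => lt_asymm (hs k hk) h
    have h3 : ∑ k ∈ s, min (v k) (max 0 (q - ∑ k' ∈ insert a s with r k' k, v k')) =
        min q (∑ k ∈ s, v k) := by
      rw [← ih]
      exact Finset.sum_congr rfl fun k hk => by rw [h2 k hk]
    rw [h1, h3]
    have := hv a
    rcases le_total q (∑ k ∈ s, v k) with h | h
    · rw [max_eq_left (by linarith), min_eq_right this, min_eq_left h,
        min_eq_left (by linarith), zero_add]
    · rw [max_eq_right (by linarith), min_eq_right h]
      rcases le_total (v a) (q - ∑ k ∈ s, v k) with h' | h'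
      · rw [min_eq_left h', min_eq_right (by linarith)]
      · rw [min_eq_right h', min_eq_left (by linarith)]; ring

/-- A maximizer of a linear form over the simplex is supported on the largest coefficients. -/
lemma IsMaxOn.coeff_stdSimplex {ι : Type*} [Fintype ι] {a p : ι → ℝ}
    (hp : p ∈ stdSimplex ℝ ι)
    (h : IsMaxOn (fun q : ι → ℝ => ∑ c, q c * a c) (stdSimplex ℝ ι) p) :
    (∀ c, a c ≤ ∑ c', p c' * a c') ∧ ∀ c, 0 < p c → a c = ∑ c', p c' * a c' := by
  classical
  have hle : ∀ c, a c ≤ ∑ c', p c' * a c' := by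
    intro c
    have := h (single_mem_stdSimplex ℝ c)
    simpa [Pi.single_apply] using this
  refine ⟨hle, fun c hc => ?_⟩
  set v := ∑ c', p c' * a c' with hv
  have h0 : ∑ c, p c * (v - a c) = 0 := by
    simp only [mul_sub, Finset.sum_sub_distrib, ← Finset.sum_mul, hp.2, ← hv]
    ring
  have h1 := (Finset.sum_eq_zero_iff_of_nonneg fun c _ =>
    mul_nonneg (hp.1 c) (sub_nonneg.2 (hle c))).1 h0 c (Finset.mem_univ c)
  rcases mul_eq_zero.1 h1 with h2 | h2
  · exact absurd h2 hc.ne'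
  · linarith

namespace DigitalMarket

open scoped Classical

/-! ### Accounting, Walras's law and market clearing -/

section Market

variable {A J : Type*} {S : J → Type*}

lemma available_nonneg {y : A → Option J → ℝ} (hy : 0 ≤ y) (j : J) (k : A ⊕ S j) :
    0 ≤ available y j k := by
  rcases k with i | k
  · exact hy i (some j)
  · exact zero_le_one

variable [Fintype A] [∀ j, Fintype (S j)]

lemma available_le_totalAvailable {y : A → Option J → ℝ} (hy : 0 ≤ y) (j : J) (k : A ⊕ S j) :
    available y j k ≤ totalAvailable S y j :=
  Finset.single_le_sum (fun k _ => available_nonneg hy j k) (Finset.mem_univ k)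

lemma one_le_totalAvailable {y : A → Option J → ℝ} (hy : 0 ≤ y) (j : J) [Nonempty (S j)] :
    1 ≤ totalAvailable S y j :=
  available_le_totalAvailable hy j (Sum.inr (Classical.arbitrary (S j)))

lemma sold_some (e : MarketState A J S) (j : J) :
    sold e (some j) = ∑ k : A ⊕ S j, excessSupply e j k +
      ∑ k : A ⊕ S j, ∑ i, e.detail i j k := by
  simp only [sold, Finset.sum_add_distrib]

variable [Fintype J]

lemma sum_min_residual (m : DigitalMarket A J S) {y : A → Option J → ℝ} (hy : 0 ≤ y) (i : A)
    (j : J) {q : ℝ} (hq : 0 ≤ q) :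
    ∑ k : A ⊕ S j, min (available y j k) (m.residual y i j q k) =
      min q (totalAvailable S y j) := by
  have := m.prefers_total i j
  have h := sum_min_max_sub_sum (m.prefers i j) (available_nonneg (S := S) hy j) hq
  rw [totalAvailable, ← h]
  refine Finset.sum_congr rfl fun k _ => ?_
  rw [residual]

/-- States in which prices are normalized, nobody spends more than she earns, and the details of
the allocation follow the rankings. -/
structure IsBudgetFeasible (m : DigitalMarket A J S) (e : MarketState A J S) : Prop where
  price_mem : e.price ∈ stdSimplex ℝ (Option J)
  production_nonneg : 0 ≤ e.production
  amount_nonneg : 0 ≤ e.amount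
  detail_eq : ∀ i j k, e.detail i j k =
    min (available e.production j k) (m.residual e.production i j (e.amount i (some j)) k)
  budget : ∀ i, ∑ c, e.price c * e.amount i c ≤ m.earnings e i

/-- Each copy sold pays exactly one agent; the initial songs are regrouped by the fibres of `owner`.
-/
lemma sum_earnings (m : DigitalMarket A J S) (e : MarketState A J S) :
    ∑ i, m.earnings e i = e.price none * ∑ i, e.production i none +
      ∑ j, e.price (some j) * ∑ k : A ⊕ S j, ∑ i, e.detail i j k := by
  simp only [earnings, ownedSales, Finset.sum_add_distrib, Fintype.sum_sum_type]
  rw [Finset.mul_sum, Finset.sum_comm]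
  congr 1
  refine Finset.sum_congr rfl fun j _ => ?_
  rw [← Finset.mul_sum, Finset.sum_add_distrib,
    Finset.sum_fiberwise Finset.univ (m.owner j) fun k => ∑ b, e.detail b j (Sum.inr k), add_comm]

namespace IsBudgetFeasible

variable {m : DigitalMarket A J S} {e : MarketState A J S}

lemma detail_nonneg (h : m.IsBudgetFeasible e) (i : A) (j : J) (k : A ⊕ S j) :
    0 ≤ e.detail i j k := by
  rw [h.detail_eq]
  exact le_min (available_nonneg h.production_nonneg j k) (le_max_left _ _)

lemma detail_le (h : m.IsBudgetFeasible e) (i : A) (j : J) (k : A ⊕ S j) :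
    e.detail i j k ≤ available e.production j k := by
  rw [h.detail_eq]
  exact min_le_left _ _

lemma sum_detail (h : m.IsBudgetFeasible e) (i : A) (j : J) :
    ∑ k, e.detail i j k = min (e.amount i (some j)) (totalAvailable S e.production j) := by
  simp only [h.detail_eq]
  exact m.sum_min_residual h.production_nonneg i j (h.amount_nonneg i (some j))

lemma sold_none_nonneg (h : m.IsBudgetFeasible e) : 0 ≤ sold e none :=
  Finset.sum_nonneg fun i _ => h.production_nonneg i none

lemma sold_some_of_amount_le (h : m.IsBudgetFeasible e)
    (hle : ∀ i j, e.amount i (some j) ≤ totalAvailable S e.production j) (j : J) :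
    sold e (some j) = ∑ k : A ⊕ S j, excessSupply e j k + bought e (some j) := by
  rw [sold_some, Finset.sum_comm]
  congr 1
  exact Finset.sum_congr rfl fun i _ => by rw [h.sum_detail, min_eq_left (hle i j)]

variable [Nonempty A]

lemma excessSupply_nonneg (h : m.IsBudgetFeasible e) (j : J) (k : A ⊕ S j) :
    0 ≤ excessSupply e j k :=
  sub_nonneg.2 (ciSup_le fun i => h.detail_le i j k)

lemma excessSupply_eq_zero_iff (h : m.IsBudgetFeasible e) (j : J) (k : A ⊕ S j) :
    excessSupply e j k = 0 ↔ ∃ i, e.detail i j k = available e.production j k := by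
  constructor
  · intro h0
    obtain ⟨i, hi⟩ := exists_eq_ciSup_of_finite (f := fun i => e.detail i j k)
    exact ⟨i, by rw [hi]; exact (sub_eq_zero.1 h0).symm⟩
  · rintro ⟨i, hi⟩
    refine le_antisymm (sub_nonpos.2 ?_) (h.excessSupply_nonneg j k)
    rw [← hi]
    exact le_ciSup (f := fun i => e.detail i j k) (Set.finite_range _).bddAbove i

/-- The largest purchase from a source is at most the sum of all purchases from it. Together with an
initial song this keeps the digital denominators away from 0. -/
lemma totalAvailable_le_sold (h : m.IsBudgetFeasible e) (j : J) :
    totalAvailable S e.production j ≤ sold e (some j) := by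
  refine Finset.sum_le_sum fun k _ => ?_
  have : ⨆ i, e.detail i j k ≤ ∑ i, e.detail i j k := ciSup_le fun i =>
    Finset.single_le_sum (f := fun i => e.detail i j k) (fun i _ => h.detail_nonneg i j k)
      (Finset.mem_univ i)
  simp only [excessSupply]
  linarith

lemma sold_pos (h : m.IsBudgetFeasible e) (j : J) [Nonempty (S j)] : 0 < sold e (some j) :=
  one_pos.trans_le ((one_le_totalAvailable h.production_nonneg j).trans
    (h.totalAvailable_le_sold j))

/-- A weak form of Walras's law. -/
lemma sum_price_mul_bought_le (h : m.IsBudgetFeasible e) :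
    ∑ c, e.price c * bought e c ≤ ∑ c, e.price c * sold e c := by
  have h1 : ∑ c, e.price c * bought e c ≤ ∑ i, m.earnings e i := by
    simp only [bought, Finset.mul_sum]
    rw [Finset.sum_comm]
    exact Finset.sum_le_sum fun i _ => h.budget i
  refine h1.trans ?_
  rw [sum_earnings, Fintype.sum_option]
  refine add_le_add le_rfl (Finset.sum_le_sum fun j _ =>
    mul_le_mul_of_nonneg_left ?_ (h.price_mem.1 _))
  rw [sold_some]
  linarith [Finset.sum_nonneg fun k (_ : k ∈ Finset.univ) => h.excessSupply_nonneg j k]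

end IsBudgetFeasible

/-- The ratios of demand to supply that steer the price update. -/
noncomputable def demandRatio (e : MarketState A J S) : Option J → ℝ
  | none => (bought e none + 1) / (sold e none + 1)
  | some j => bought e (some j) / sold e (some j)

lemma priceObjective_eq (e : MarketState A J S) :
    priceObjective e = fun q => ∑ c, q c * demandRatio e c := by
  ext q
  rw [Fintype.sum_option]
  rfl

namespace IsBudgetFeasible

variable {m : DigitalMarket A J S} {e : MarketState A J S} [Nonempty A] [∀ j, Nonempty (S j)]

lemma demandRatio_le_one_iff (h : m.IsBudgetFeasible e) (c : Option J) :
    demandRatio e c ≤ 1 ↔ bought e c ≤ sold e c := by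
  rcases c with - | j
  · have := h.sold_none_nonneg
    simp only [demandRatio]
    rw [div_le_one (by linarith)]
    simp
  · exact div_le_one (h.sold_pos j)

lemma demandRatio_eq_one_iff (h : m.IsBudgetFeasible e) (c : Option J) :
    demandRatio e c = 1 ↔ bought e c = sold e c := by
  rcases c with - | j
  · have := h.sold_none_nonneg
    simp only [demandRatio]
    rw [div_eq_one_iff_eq (by linarith)]
    simp
  · exact div_eq_one_iff_eq (h.sold_pos j).ne'

/-- All goods with a positive price share the maximal ratio. If it exceeded 1, each of them would be
bought in excess of its supply, against the weak Walras law. -/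
lemma bought_le_sold (h : m.IsBudgetFeasible e)
    (hmax : IsMaxOn (priceObjective e) (stdSimplex ℝ (Option J)) e.price) (c : Option J) :
    bought e c ≤ sold e c := by
  rw [priceObjective_eq] at hmax
  obtain ⟨hle, heq⟩ := hmax.coeff_stdSimplex h.price_mem
  rw [← h.demandRatio_le_one_iff]
  refine (hle c).trans ?_
  by_contra! hlt
  have hlt' : ∀ c, 0 < e.price c → sold e c < bought e c := by
    intro c hc
    rw [← not_le, ← h.demandRatio_le_one_iff, heq c hc, not_le]
    exact hlt
  obtain ⟨c₀, hc₀⟩ : ∃ c, 0 < e.price c := by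
    by_contra! hall
    have := Finset.sum_nonpos fun c (_ : c ∈ Finset.univ) => hall c
    rw [h.price_mem.2] at this
    linarith
  refine absurd h.sum_price_mul_bought_le (not_le.2 ?_)
  refine Finset.sum_lt_sum (fun c _ => ?_) ⟨c₀, Finset.mem_univ _,
    mul_lt_mul_of_pos_left (hlt' c₀ hc₀) hc₀⟩
  rcases (h.price_mem.1 c).eq_or_lt with h0 | h0
  · rw [← h0, zero_mul, zero_mul]
  · exact mul_le_mul_of_nonneg_left (hlt' c h0).le h0.le

/-- An agent wanting more than everything exhausts every source, so there is no excess supply in the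
category. What is sold is then only the sum of the details, which falls short of what is bought. -/
lemma amount_le_totalAvailable (h : m.IsBudgetFeasible e)
    (hmax : IsMaxOn (priceObjective e) (stdSimplex ℝ (Option J)) e.price) (i : A) (j : J) :
    e.amount i (some j) ≤ totalAvailable S e.production j := by
  by_contra! hlt
  have h1 := h.sum_detail i j
  rw [min_eq_right hlt.le] at h1
  have h2 : ∀ k, e.detail i j k = available e.production j k := by
    have h0 : ∑ k, (available e.production j k - e.detail i j k) = 0 := by
      rw [Finset.sum_sub_distrib, h1]
      exact sub_self _
    intro k
    have := (Finset.sum_eq_zero_iff_of_nonneg fun k _ =>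
      sub_nonneg.2 (h.detail_le i j k)).1 h0 k (Finset.mem_univ k)
    linarith
  have h3 : ∀ k, excessSupply e j k = 0 := fun k =>
    (h.excessSupply_eq_zero_iff j k).2 ⟨i, h2 k⟩
  have h4 := h.bought_le_sold hmax (some j)
  rw [sold_some, Finset.sum_eq_zero fun k _ => h3 k, zero_add, Finset.sum_comm] at h4
  refine absurd h4 (not_le.2 (Finset.sum_lt_sum (fun i _ => ?_) ⟨i, Finset.mem_univ i, ?_⟩))
  · rw [h.sum_detail]; exact min_le_left _ _
  · rw [h1]; exact hlt

/-- If all prices are positive and all budgets are exhausted, a price vector that maximizes the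
objective clears the market. -/
lemma marketClears (h : m.IsBudgetFeasible e)
    (hmax : IsMaxOn (priceObjective e) (stdSimplex ℝ (Option J)) e.price)
    (hpos : ∀ c, 0 < e.price c)
    (hbudget : ∀ i, ∑ c, e.price c * e.amount i c = m.earnings e i) : MarketClears e := by
  have hle := h.amount_le_totalAvailable hmax
  have hsold := h.sold_some_of_amount_le hle
  have hdet : ∀ j, ∑ k : A ⊕ S j, ∑ i, e.detail i j k = bought e (some j) := by
    intro j
    rw [Finset.sum_comm]
    exact Finset.sum_congr rfl fun i _ => by rw [h.sum_detail, min_eq_left (hle i j)]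
  -- The value of all purchases equals all earnings, and by `hdet` the digital terms on both sides
  -- agree.
  have hbread : bought e none = sold e none := by
    have h1 : ∑ c, e.price c * bought e c = ∑ i, m.earnings e i := by
      simp only [bought, Finset.mul_sum]
      rw [Finset.sum_comm]
      exact Finset.sum_congr rfl fun i _ => hbudget i
    rw [sum_earnings, Fintype.sum_option] at h1
    simp only [hdet, add_left_inj] at h1
    exact mul_left_cancel₀ (hpos none).ne' h1
  refine ⟨hbread, fun j _ k => ?_, hle⟩
  rw [priceObjective_eq] at hmax
  obtain ⟨-, heq⟩ := hmax.coeff_stdSimplex h.price_mem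
  have hr : demandRatio e (some j) = 1 := by
    rw [heq _ (hpos _), ← heq _ (hpos none), h.demandRatio_eq_one_iff, hbread]
  rw [h.demandRatio_eq_one_iff, hsold] at hr
  rw [← h.excessSupply_eq_zero_iff]
  exact (Finset.sum_eq_zero_iff_of_nonneg fun k _ => h.excessSupply_nonneg j k).1
    (by linarith) k (Finset.mem_univ k)

/-- If all prices are positive and the market clears, every price vector maximizes the
objective. -/
lemma isMaxOn_priceObjective (h : m.IsBudgetFeasible e) (hclear : MarketClears e)
    (hpos : ∀ c, 0 < e.price c) :
    IsMaxOn (priceObjective e) (stdSimplex ℝ (Option J)) e.price := by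
  have hone : ∀ c, demandRatio e c = 1 := by
    intro c
    rw [h.demandRatio_eq_one_iff]
    rcases c with - | j
    · exact hclear.1
    · rw [h.sold_some_of_amount_le hclear.2.2, Finset.sum_eq_zero fun k _ =>
        (h.excessSupply_eq_zero_iff j k).2 (hclear.2.1 j (hpos _) k), zero_add]
  rw [priceObjective_eq]
  intro q hq
  change ∑ c, q c * _ ≤ ∑ c, e.price c * _
  simp only [hone, mul_one]
  rw [hq.2, h.price_mem.2]

end IsBudgetFeasible

end Market

end DigitalMarket

namespace DigitalMarket

open scoped Classical

/-! ### The consumer's problem and flattened utilities -/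

section Bundles

lemma exists_smul_lt {ι : Type*} {u : (ι → ℝ) → ℝ} (hc : ContinuousOn u (Set.Ici 0))
    {z : ι → ℝ} (hz : 0 ≤ z) {a : ℝ} (ha : a < u z) : ∃ t ∈ Set.Ioo (0 : ℝ) 1, a < u (t • z) := by
  have h1 : ContinuousOn (fun t : ℝ => u (t • z)) (Set.Ici 0) :=
    hc.comp (by fun_prop) fun t ht => smul_nonneg ht hz
  have h2 : ContinuousAt (fun t : ℝ => u (t • z)) 1 := h1.continuousAt (Ici_mem_nhds one_pos)
  have h3 : ∀ᶠ t in nhdsWithin (1 : ℝ) (Set.Iio 1), a < u (t • z) :=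
    (h2.eventually (lt_mem_nhds (by simpa using ha))).filter_mono nhdsWithin_le_nhds
  obtain ⟨t, ht, ht'⟩ := (h3.and (Ioo_mem_nhdsLT one_pos)).exists
  exact ⟨t, ht', ht⟩

lemma sum_mul_smul {ι : Type*} [Fintype ι] (p z : ι → ℝ) (t : ℝ) :
    ∑ c, p c * (t • z) c = t * ∑ c, p c * z c := by
  rw [Finset.mul_sum]
  exact Finset.sum_congr rfl fun c _ => by simp only [Pi.smul_apply, smul_eq_mul]; ring

lemma sum_mul_add_single {ι : Type*} [Fintype ι] [DecidableEq ι] (p z : ι → ℝ) (c : ι) (t : ℝ) :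
    ∑ c', p c' * (z + Pi.single c t : ι → ℝ) c' = ∑ c', p c' * z c' + p c * t := by
  simp [mul_add, Finset.sum_add_distrib, Pi.single_apply]

lemma utility_lt_add_single {ι : Type*} [DecidableEq ι] {u : (ι → ℝ) → ℝ}
    (hmono : StrictMonoOn u (Set.Ici 0)) {z : ι → ℝ} (hz : 0 ≤ z) (c : ι) {t : ℝ} (ht : 0 < t) :
    0 ≤ z + Pi.single c t ∧ u z < u (z + Pi.single c t) := by
  have hs : (0 : ι → ℝ) < Pi.single c t := by
    refine lt_of_le_of_ne (Pi.single_nonneg.2 ht.le) fun h => ?_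
    have := congrFun h c
    simp [ht.ne] at this
  exact ⟨add_nonneg hz hs.le, hmono hz (add_nonneg hz hs.le) (lt_add_of_pos_right z hs)⟩

variable {J : Type*} [Fintype J] {u : (Option J → ℝ) → ℝ} {p z : Option J → ℝ} {w B : ℝ}

/-- Truncating a competing bundle at `B` only makes it cheaper. -/
lemma IsOptimalBundle.flat (h : IsOptimalBundle u p w z) (hp : 0 ≤ p) (hB : 0 ≤ B)
    (hz : ∀ c, z c ≤ B) : IsOptimalBundle (fun z => u fun c => min (z c) B) p w z := by
  refine ⟨h.1, h.2.1, fun z' hz' hw => ?_⟩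
  have hzB : (fun c => min (z c) B) = z := funext fun c => min_eq_left (hz c)
  simp only [hzB]
  refine h.2.2 _ (fun c => le_min (hz' c) hB) (le_trans ?_ hw)
  exact Finset.sum_le_sum fun c _ => mul_le_mul_of_nonneg_left (min_le_left _ _) (hp c)

/-- A bundle that is optimal for a utility flattened above `B` and stays below `B` is optimal for
the utility itself. -/
lemma IsOptimalBundle.of_flat (h : IsOptimalBundle (fun z => u fun c => min (z c) B) p w z)
    (hz : ∀ c, z c < B) (hcont : ContinuousOn u (Set.Ici 0))
    (hconc : QuasiconcaveOn ℝ (Set.Ici 0) u) (hmono : StrictMonoOn u (Set.Ici 0)) :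
    IsOptimalBundle u p w z := by
  refine ⟨h.1, h.2.1, fun z' hz' hw => ?_⟩
  by_contra! hlt
  obtain ⟨s, ⟨hs0, hs1⟩, hs⟩ := exists_smul_lt hcont hz' hlt
  have hsz : s • z' < z' := by
    refine lt_of_le_of_ne (fun c => ?_) fun heq => ?_
    · simpa using mul_le_of_le_one_left (hz' c) hs1.le
    · have h0 : z' = 0 := by
        have h1 : (1 - s) • z' = 0 := by rw [sub_smul, one_smul, heq, sub_self]
        exact (smul_eq_zero.1 h1).resolve_left (by linarith)
      rw [h0] at hlt
      exact absurd (hmono.monotoneOn (Set.self_mem_Ici) h.1 h.1) (not_le.2 hlt)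
  have hev : ∀ᶠ t in nhds (0 : ℝ), ∀ c, ((1 - t) • z + t • z') c < B := by
    rw [Filter.eventually_all]
    intro c
    have hc : ContinuousAt (fun t : ℝ => ((1 - t) • z + t • z') c) 0 := by
      simp only [Pi.add_apply, Pi.smul_apply]
      fun_prop
    exact hc.eventually (gt_mem_nhds (by simpa using hz c))
  obtain ⟨t, ht, ht0, ht1⟩ :=
    ((hev.filter_mono nhdsWithin_le_nhds).and (Ioo_mem_nhdsGT one_pos)).exists
  have ht1' : 0 ≤ 1 - t := by linarith
  -- Quasi-concavity alone gives a weak inequality at a mixture. It is applied to the shrunken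
  -- bundle `s • z'`, which is still better than `z`; restoring `z'` then makes the inequality
  -- strict by monotonicity. The small `t` keeps the mixture below `B`, where flattening is not
  -- felt.
  have hle : u z ≤ u ((1 - t) • z + t • s • z') := by
    refine (hconc (u z) ⟨h.1, le_rfl⟩ ⟨?_, hs.le⟩ ht1' ht0.le (by ring)).2
    exact smul_nonneg hs0.le hz'
  have hlt' : u ((1 - t) • z + t • s • z') < u ((1 - t) • z + t • z') := by
    refine hmono ?_ ?_ ?_
    · exact add_nonneg (smul_nonneg ht1' h.1) (smul_nonneg ht0.le (smul_nonneg hs0.le hz'))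
    · exact add_nonneg (smul_nonneg ht1' h.1) (smul_nonneg ht0.le hz')
    · have := smul_lt_smul_of_pos_left hsz ht0
      gcongr
  have hopt := h.2.2 ((1 - t) • z + t • z')
    (add_nonneg (smul_nonneg ht1' h.1) (smul_nonneg ht0.le hz')) (by
      have hsum : ∑ c, p c * ((1 - t) • z + t • z') c =
          (1 - t) * ∑ c, p c * z c + t * ∑ c, p c * z' c := by
        rw [← sum_mul_smul, ← sum_mul_smul, ← Finset.sum_add_distrib]
        exact Finset.sum_congr rfl fun c _ => by rw [Pi.add_apply, mul_add]
      rw [hsum]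
      have := mul_le_mul_of_nonneg_left h.2.1 ht1'
      have := mul_le_mul_of_nonneg_left hw ht0.le
      linarith)
  have e1 : (fun c => min (((1 - t) • z + t • z') c) B) = (1 - t) • z + t • z' :=
    funext fun c => min_eq_left (ht c).le
  have e2 : (fun c => min (z c) B) = z := funext fun c => min_eq_left (hz c).le
  simp only [e1, e2] at hopt
  linarith

lemma IsOptimalBundle.price_pos (h : IsOptimalBundle u p w z)
    (hmono : StrictMonoOn u (Set.Ici 0)) (c : Option J) : 0 < p c := by
  by_contra! hc
  obtain ⟨h1, h2⟩ := utility_lt_add_single hmono h.1 c one_pos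
  refine absurd (h.2.2 _ h1 ?_) (not_le.2 h2)
  rw [sum_mul_add_single]
  linarith [h.2.1]

lemma IsOptimalBundle.budget_eq (h : IsOptimalBundle u p w z)
    (hmono : StrictMonoOn u (Set.Ici 0)) : ∑ c, p c * z c = w := by
  refine h.2.1.eq_of_not_lt fun hlt => ?_
  have hp := h.price_pos hmono none
  obtain ⟨h1, h2⟩ := utility_lt_add_single hmono h.1 none (div_pos (sub_pos.2 hlt) hp)
  refine absurd (h.2.2 _ h1 ?_) (not_le.2 h2)
  rw [sum_mul_add_single, mul_div_cancel₀ _ hp.ne']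
  linarith

end Bundles

/-! ### Fixed points versus equilibria -/

section Correspondence

variable {A J : Type*} {S : J → Type*} [Fintype A] [Fintype J] [∀ j, Fintype (S j)]
  {m : DigitalMarket A J S} {e : MarketState A J S} {M : ℝ}

lemma IsSupplyBound.pos [Nonempty A] (hM : m.IsSupplyBound M) : 0 < M := by
  choose y hy hpos using m.feasible_bread
  exact (Finset.sum_pos (fun i _ => hpos i) Finset.univ_nonempty).trans_le (hM y hy).1

/-- Bread is rival, so a bound on total purchases suffices; songs are not, so each agent's quantity
needs its own bound. -/
lemma amount_le_of_bought_le (hM : m.IsSupplyBound M)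
    (hy : ∀ i, e.production i ∈ m.feasible i) (hz : 0 ≤ e.amount)
    (hbread : bought e none ≤ sold e none)
    (hle : ∀ i j, e.amount i (some j) ≤ totalAvailable S e.production j) (i : A)
    (c : Option J) : e.amount i c ≤ M := by
  rcases c with - | j
  · exact ((Finset.single_le_sum (f := fun i => e.amount i none) (fun i _ => hz i none)
      (Finset.mem_univ i)).trans hbread).trans (hM _ hy).1
  · exact (hle i j).trans ((hM _ hy).2 j)

lemma production_le (hM : m.IsSupplyBound M) (hy : ∀ i, e.production i ∈ m.feasible i) (i : A)
    (c : Option J) : e.production i c ≤ M := by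
  have h0 : 0 ≤ e.production := fun i => m.feasible_nonneg i _ (hy i)
  rcases c with - | j
  · exact (Finset.single_le_sum (f := fun i => e.production i none) (fun i _ => h0 i none)
      (Finset.mem_univ i)).trans (hM _ hy).1
  · exact (available_le_totalAvailable (S := S) h0 j (Sum.inl i)).trans ((hM _ hy).2 j)

variable [Nonempty A]

lemma mem_domain (hM : m.IsSupplyBound M) (hy : ∀ i, e.production i ∈ m.feasible i)
    (h : m.IsBudgetFeasible e) (hz : ∀ i c, e.amount i c ≤ 1.1 * M) : e ∈ domain S M := by
  have hpos := hM.pos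
  have h0 := h.production_nonneg
  refine ⟨h.price_mem, fun i c => ⟨h.amount_nonneg i c, hz i c⟩,
    fun i j k => ⟨h.detail_nonneg i j k, ?_⟩, fun i c => ⟨h0 i c, ?_⟩⟩
  · linarith [h.detail_le i j k, available_le_totalAvailable (S := S) h0 j k, (hM _ hy).2 j]
  · linarith [production_le hM hy i c]

variable [∀ j, Nonempty (S j)]

/-- Fixed points of the correspondence are equilibria. -/
theorem isEquilibrium_of_mem_correspondence (hM : m.IsSupplyBound M)
    (he : e ∈ m.correspondence M e) : m.IsEquilibrium e := by
  obtain ⟨hdom, hopt, hprod, hmax⟩ := he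
  have hpos := hM.pos
  have hy : ∀ i, e.production i ∈ m.feasible i := fun i => (hprod i).1
  have h : m.IsBudgetFeasible e :=
    { price_mem := hdom.1
      production_nonneg := fun i => m.feasible_nonneg i _ (hy i)
      amount_nonneg := fun i => (hopt i).1.1
      detail_eq := fun i => (hopt i).2
      budget := fun i => (hopt i).1.2.1 }
  have hlt : ∀ i c, e.amount i c < 1.1 * M := fun i c => by
    linarith [amount_le_of_bought_le hM hy h.amount_nonneg (h.bought_le_sold hmax none)
      (h.amount_le_totalAvailable hmax) i c]
  have htrue : ∀ i, IsOptimalBundle (m.utility i) e.price (m.earnings e i) (e.amount i) :=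
    fun i => IsOptimalBundle.of_flat (hopt i).1 (hlt i) (m.utility_continuous i)
      (m.utility_quasiconcave i) (m.utility_nonsatiated i)
  exact
    { price_nonneg := hdom.1.1
      optimal_production := hprod
      optimal_allocation := fun i => ⟨htrue i, (hopt i).2⟩
      clears := h.marketClears hmax
        ((htrue (Classical.arbitrary A)).price_pos (m.utility_nonsatiated _))
        fun i => (htrue i).budget_eq (m.utility_nonsatiated i) }

/-- Equilibria with normalized prices are fixed points of the correspondence. -/
theorem IsEquilibrium.mem_correspondence (hM : m.IsSupplyBound M) (h : m.IsEquilibrium e)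
    (hp : e.price ∈ stdSimplex ℝ (Option J)) : e ∈ m.correspondence M e := by
  have hpos := hM.pos
  have hy : ∀ i, e.production i ∈ m.feasible i := fun i => (h.optimal_production i).1
  have hb : m.IsBudgetFeasible e :=
    { price_mem := hp
      production_nonneg := fun i => m.feasible_nonneg i _ (hy i)
      amount_nonneg := fun i => (h.optimal_allocation i).1.1
      detail_eq := fun i => (h.optimal_allocation i).2
      budget := fun i => (h.optimal_allocation i).1.2.1 }
  have hle : ∀ i c, e.amount i c ≤ 1.1 * M := fun i c => by
    linarith [amount_le_of_bought_le hM hy hb.amount_nonneg h.clears.1.le h.clears.2.2 i c]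
  refine ⟨mem_domain hM hy hb hle, fun i => ⟨?_, (h.optimal_allocation i).2⟩,
    h.optimal_production, hb.isMaxOn_priceObjective h.clears
      ((h.optimal_allocation (Classical.arbitrary A)).1.price_pos (m.utility_nonsatiated _))⟩
  exact (h.optimal_allocation i).1.flat hp.1 (by positivity) (hle i)

end Correspondence

end DigitalMarket

namespace DigitalMarket

open scoped Classical

/-! ### Existence through quasi-demands -/

section Existence

variable {A J : Type*} {S : J → Type*}

/-- Prices, coarse allocations and productions. -/
abbrev CoarseState (A J : Type*) : Type _ :=
  (Option J → ℝ) × (A → Option J → ℝ) × (A → Option J → ℝ)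

lemma continuous_available (j : J) (k : A ⊕ S j) :
    Continuous fun q : CoarseState A J => available q.2.2 j k := by
  rcases k with i | k
  · simp only [available]
    fun_prop
  · exact continuous_const

variable [Fintype A] [Fintype J]

/-- The compact convex set on which equilibria are sought. -/
def coarseDomain (m : DigitalMarket A J S) (B : ℝ) : Set (CoarseState A J) :=
  stdSimplex ℝ (Option J) ×ˢ
    (Set.univ.pi fun _ => Set.Icc 0 fun _ => B) ×ˢ Set.univ.pi m.feasible

lemma isCompact_coarseDomain (m : DigitalMarket A J S) (B : ℝ) :
    IsCompact (m.coarseDomain B) :=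
  (isCompact_stdSimplex ℝ _).prod ((isCompact_univ_pi fun _ => isCompact_Icc).prod
    (isCompact_univ_pi m.feasible_compact))

lemma convex_coarseDomain (m : DigitalMarket A J S) (B : ℝ) : Convex ℝ (m.coarseDomain B) :=
  (convex_stdSimplex ℝ _).prod ((convex_pi fun _ _ => convex_Icc _ _).prod
    (convex_pi fun i _ => m.feasible_convex i))

lemma coarseDomain_nonempty (m : DigitalMarket A J S) {B : ℝ} (hB : 0 ≤ B) :
    (m.coarseDomain B).Nonempty := by
  choose y hy _ using m.feasible_bread
  exact ⟨(Pi.single none 1, 0, y), single_mem_stdSimplex ℝ none,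
    fun _ _ => ⟨le_rfl, fun _ => hB⟩, fun i _ => hy i⟩

lemma coarseDomain_production_nonneg {m : DigitalMarket A J S} {B : ℝ} {q : CoarseState A J}
    (hq : q ∈ m.coarseDomain B) : 0 ≤ q.2.2 := fun i => m.feasible_nonneg i _ (hq.2.2 i trivial)

variable [∀ j, Fintype (S j)]

lemma exists_isSupplyBound (m : DigitalMarket A J S) : ∃ M, m.IsSupplyBound M := by
  have hb : ∀ i, ∃ B, ∀ y ∈ m.feasible i, ∀ c, y c ≤ B := by
    intro i
    obtain ⟨B, hB⟩ := (m.feasible_compact i).isBounded.exists_norm_le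
    exact ⟨B, fun y hy c => (le_abs_self _).trans ((norm_le_pi_norm y c).trans (hB y hy))⟩
  choose B hB using hb
  refine ⟨∑ i, B i + ∑ j, (Fintype.card (S j) : ℝ), fun y hy => ⟨?_, fun j => ?_⟩⟩
  · exact le_add_of_le_of_nonneg (Finset.sum_le_sum fun i _ => hB i _ (hy i) none)
      (Finset.sum_nonneg fun j _ => Nat.cast_nonneg _)
  · rw [totalAvailable, Fintype.sum_sum_type]
    refine add_le_add (Finset.sum_le_sum fun i _ => hB i _ (hy i) (some j)) ?_
    have := Finset.single_le_sum (f := fun j => (Fintype.card (S j) : ℝ))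
      (fun j _ => Nat.cast_nonneg _) (Finset.mem_univ j)
    simpa [available] using this

/-- The state in which the details of a coarse allocation follow the rankings. -/
noncomputable def greedyState (m : DigitalMarket A J S) (q : CoarseState A J) :
    MarketState A J S where
  price := q.1
  amount := q.2.1
  detail i j k := min (available q.2.2 j k) (m.residual q.2.2 i j (q.2.1 i (some j)) k)
  production := q.2.2

lemma continuous_residual (m : DigitalMarket A J S) (i : A) (j : J) (k : A ⊕ S j) :
    Continuous fun q : CoarseState A J => m.residual q.2.2 i j (q.2.1 i (some j)) k := by
  have := continuous_available (A := A) (S := S) j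
  simp only [residual]
  fun_prop

lemma continuous_detail (m : DigitalMarket A J S) (i : A) (j : J) (k : A ⊕ S j) :
    Continuous fun q : CoarseState A J => (m.greedyState q).detail i j k :=
  (continuous_available j k).min (m.continuous_residual i j k)

lemma continuous_earnings (m : DigitalMarket A J S) (i : A) :
    Continuous fun q : CoarseState A J => m.earnings (m.greedyState q) i := by
  have := m.continuous_detail
  simp only [earnings, ownedSales]
  simp only [greedyState] at this ⊢
  fun_prop

lemma continuous_potentialEarnings (m : DigitalMarket A J S) (i : A) :
    Continuous fun r : CoarseState A J × (Option J → ℝ) =>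
      m.potentialEarnings (m.greedyState r.1) i r.2 := by
  have h1 := fun i j k => (m.continuous_detail i j k).comp
    (continuous_fst (X := CoarseState A J) (Y := Option J → ℝ))
  have h2 := fun i j k => (m.continuous_residual i j k).comp
    (continuous_fst (X := CoarseState A J) (Y := Option J → ℝ))
  simp only [Function.comp_def] at h1 h2
  simp only [potentialEarnings, ownedSales]
  simp only [greedyState] at h1 ⊢
  fun_prop

lemma continuous_bought (m : DigitalMarket A J S) (c : Option J) :
    Continuous fun q : CoarseState A J => bought (m.greedyState q) c := by
  simp only [bought, greedyState]
  fun_prop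

lemma continuous_sold [Nonempty A] (m : DigitalMarket A J S) (c : Option J) :
    Continuous fun q : CoarseState A J => sold (m.greedyState q) c := by
  rcases c with - | j
  · simp only [sold, greedyState]
    fun_prop
  · have h1 := m.continuous_detail
    have h2 := continuous_available (A := A) (S := S) j
    have h3 : ∀ k : A ⊕ S j, Continuous fun q : CoarseState A J =>
        ⨆ i, (m.greedyState q).detail i j k := by
      intro k
      simp only [← Finset.sup'_univ_eq_ciSup]
      exact Continuous.finset_sup'_apply _ fun i _ => h1 i j k
    have h4 : ∀ k : A ⊕ S j, Continuous fun q : CoarseState A J =>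
        excessSupply (m.greedyState q) j k := fun k => (h2 k).sub (h3 k)
    simp only [sold]
    fun_prop

/-- The greedy rule for the details is the rule by which potential earnings predict sales. -/
lemma potentialEarnings_greedyState (m : DigitalMarket A J S) (q : CoarseState A J) (i : A) :
    m.potentialEarnings (m.greedyState q) i (q.2.2 i) = m.earnings (m.greedyState q) i := rfl

lemma greedyState_detail_nonneg (m : DigitalMarket A J S) {q : CoarseState A J}
    (hy : 0 ≤ q.2.2) (i : A) (j : J) (k : A ⊕ S j) : 0 ≤ (m.greedyState q).detail i j k :=
  le_min (available_nonneg hy j k) (le_max_left _ _)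

/-- With a positive bread price this will make all optimal earnings positive. -/
lemma price_mul_le_potentialEarnings (m : DigitalMarket A J S) {q : CoarseState A J}
    (hp : 0 ≤ q.1) (hy : 0 ≤ q.2.2) (i : A) {v : Option J → ℝ} (hv : 0 ≤ v) :
    q.1 none * v none ≤ m.potentialEarnings (m.greedyState q) i v := by
  refine le_add_of_nonneg_right (Finset.sum_nonneg fun j _ => mul_nonneg (hp _) ?_)
  refine add_nonneg (Finset.sum_nonneg fun k _ => Finset.sum_nonneg fun b _ =>
    m.greedyState_detail_nonneg hy b j _) (Finset.sum_nonneg fun b _ => ?_)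
  exact le_min (hv _) (le_max_left _ _)

lemma earnings_greedyState_nonneg (m : DigitalMarket A J S) {q : CoarseState A J}
    (hp : 0 ≤ q.1) (hy : 0 ≤ q.2.2) (i : A) : 0 ≤ m.earnings (m.greedyState q) i := by
  rw [← potentialEarnings_greedyState]
  exact (mul_nonneg (hp none) (hy i none)).trans (m.price_mul_le_potentialEarnings hp hy i (hy i))

/-- Each sales term is the minimum of a coordinate of `v` and a constant, weighted by a nonnegative
price. This makes the set of optimal productions convex. -/
lemma concaveOn_potentialEarnings (m : DigitalMarket A J S) {e : MarketState A J S}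
    (hp : 0 ≤ e.price) (i : A) : ConcaveOn ℝ Set.univ (m.potentialEarnings e i) := by
  refine ⟨convex_univ, fun v _ v' _ a b ha hb hab => ?_⟩
  have key : ∀ j, a * (e.price (some j) * (m.ownedSales e.detail i j + ∑ b : A, min (v (some j))
        (m.residual e.production b j (e.amount b (some j)) (Sum.inl i)))) +
      b * (e.price (some j) * (m.ownedSales e.detail i j + ∑ b : A, min (v' (some j))
        (m.residual e.production b j (e.amount b (some j)) (Sum.inl i)))) ≤
      e.price (some j) * (m.ownedSales e.detail i j +
        ∑ b' : A, min ((a • v + b • v') (some j))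
        (m.residual e.production b' j (e.amount b' (some j)) (Sum.inl i))) := by
    intro j
    have h1 : a * ∑ b : A, min (v (some j))
          (m.residual e.production b j (e.amount b (some j)) (Sum.inl i)) +
        b * ∑ b : A, min (v' (some j))
          (m.residual e.production b j (e.amount b (some j)) (Sum.inl i)) ≤
        ∑ b' : A, min ((a • v + b • v') (some j))
          (m.residual e.production b' j (e.amount b' (some j)) (Sum.inl i)) := by
      rw [Finset.mul_sum, Finset.mul_sum, ← Finset.sum_add_distrib]
      refine Finset.sum_le_sum fun b' _ => ?_
      set R := m.residual e.production b' j (e.amount b' (some j)) (Sum.inl i)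
      simp only [Pi.add_apply, Pi.smul_apply, smul_eq_mul]
      refine le_min (add_le_add (mul_le_mul_of_nonneg_left (min_le_left _ _) ha)
        (mul_le_mul_of_nonneg_left (min_le_left _ _) hb)) ?_
      calc _ ≤ a * R + b * R := add_le_add (mul_le_mul_of_nonneg_left (min_le_right _ _) ha)
            (mul_le_mul_of_nonneg_left (min_le_right _ _) hb)
        _ = R := by rw [← add_mul, hab, one_mul]
    have h2 := mul_le_mul_of_nonneg_left h1 (hp (some j))
    have h3 : m.ownedSales e.detail i j =
        a * m.ownedSales e.detail i j + b * m.ownedSales e.detail i j := by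
      rw [← add_mul, hab, one_mul]
    nlinarith [congrArg (fun t => e.price (some j) * t) h3]
  have hsum := Finset.sum_le_sum fun j (_ : j ∈ Finset.univ) => key j
  rw [Finset.sum_add_distrib, ← Finset.mul_sum, ← Finset.mul_sum] at hsum
  simp only [potentialEarnings, smul_eq_mul]
  have h0 : e.price none * (a • v + b • v') none =
      a * (e.price none * v none) + b * (e.price none * v' none) := by
    simp only [Pi.add_apply, Pi.smul_apply, smul_eq_mul]
    ring
  rw [h0]
  linarith

lemma demandRatio_continuousOn [Nonempty A] [∀ j, Nonempty (S j)] (m : DigitalMarket A J S)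
    (c : Option J) :
    ContinuousOn (fun q : CoarseState A J => demandRatio (m.greedyState q) c)
      {q | 0 ≤ q.2.2} := by
  have hb := m.continuous_bought c
  have hs := m.continuous_sold c
  rcases c with - | j
  · refine ContinuousOn.div (hb.add continuous_const).continuousOn
      (hs.add continuous_const).continuousOn fun q hq => ?_
    have : 0 ≤ sold (m.greedyState q) none := Finset.sum_nonneg fun i _ => hq i none
    linarith
  · refine ContinuousOn.div hb.continuousOn hs.continuousOn fun q hq => ?_
    refine (one_pos.trans_le ((one_le_totalAvailable (S := S) hq j).trans ?_)).ne'
    refine Finset.sum_le_sum fun k _ => ?_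
    have : ⨆ i, (m.greedyState q).detail i j k ≤ ∑ i, (m.greedyState q).detail i j k :=
      ciSup_le fun i => Finset.single_le_sum (f := fun i => (m.greedyState q).detail i j k)
        (fun i _ => m.greedyState_detail_nonneg hq i j k) (Finset.mem_univ i)
    simp only [excessSupply]
    change available q.2.2 j k ≤ available q.2.2 j k - _ + _
    linarith

/-- `z` is affordable and at least as good as every bundle up to `B` that costs less than `w`. -/
def IsQuasiDemand (u : (Option J → ℝ) → ℝ) (B : ℝ) (p : Option J → ℝ) (w : ℝ)
    (z : Option J → ℝ) : Prop :=
  ∑ c, p c * z c ≤ w ∧ ∀ z' ∈ Set.Icc (0 : Option J → ℝ) (fun _ => B),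
    ∑ c, p c * z' c < w → u z' ≤ u z

/-- The responses to a coarse state: quasi-demands of the agents, optimal productions, and prices
that maximize the objective. -/
def coarseResponse (m : DigitalMarket A J S) (B : ℝ) (q : CoarseState A J) :
    Set (CoarseState A J) :=
  {q' | q' ∈ m.coarseDomain B ∧
    (∀ i, IsQuasiDemand (m.utility i) B q.1 (m.earnings (m.greedyState q) i) (q'.2.1 i)) ∧
    (∀ i, m.IsOptimalProduction (m.greedyState q) i (q'.2.2 i)) ∧
    IsMaxOn (priceObjective (m.greedyState q)) (stdSimplex ℝ (Option J)) q'.1}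

lemma convex_coarseResponse (m : DigitalMarket A J S) (B : ℝ) {q : CoarseState A J}
    (hp : 0 ≤ q.1) : Convex ℝ (m.coarseResponse B q) := by
  rintro r ⟨hr, hrx, hry, hrp⟩ s ⟨hs, hsx, hsy, hsp⟩ a b ha hb hab
  refine ⟨m.convex_coarseDomain B hr hs ha hb hab, fun i => ⟨?_, fun z hz hlt => ?_⟩,
    fun i => ⟨m.feasible_convex i (hry i).1 (hsy i).1 ha hb hab, fun v hv => ?_⟩, fun t ht => ?_⟩
  · have h1 : ∑ c, q.1 c * (a • r + b • s).2.1 i c =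
        a * ∑ c, q.1 c * r.2.1 i c + b * ∑ c, q.1 c * s.2.1 i c := by
      rw [← sum_mul_smul, ← sum_mul_smul, ← Finset.sum_add_distrib]
      exact Finset.sum_congr rfl fun c _ => mul_add _ _ _
    rw [h1]
    calc _ ≤ a * m.earnings (m.greedyState q) i + b * m.earnings (m.greedyState q) i :=
          add_le_add (mul_le_mul_of_nonneg_left (hrx i).1 ha)
            (mul_le_mul_of_nonneg_left (hsx i).1 hb)
      _ = _ := by rw [← add_mul, hab, one_mul]
  · exact (m.utility_quasiconcave i (m.utility i z)
      ⟨(hr.2.1 i trivial).1, (hrx i).2 z hz hlt⟩ ⟨(hs.2.1 i trivial).1, (hsx i).2 z hz hlt⟩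
      ha hb hab).2
  · refine le_trans ?_ ((m.concaveOn_potentialEarnings (e := m.greedyState q) hp i).2
      (Set.mem_univ (r.2.2 i)) (Set.mem_univ (s.2.2 i)) ha hb hab)
    calc _ = a • m.potentialEarnings (m.greedyState q) i v +
          b • m.potentialEarnings (m.greedyState q) i v := by rw [← add_smul, hab, one_smul]
      _ ≤ _ := add_le_add (mul_le_mul_of_nonneg_left ((hry i).2 v hv) ha)
            (mul_le_mul_of_nonneg_left ((hsy i).2 v hv) hb)
  · have h1 := hrp ht
    have h2 := hsp ht
    rw [priceObjective_eq] at h1 h2 ⊢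
    simp only at h1 h2 ⊢
    change ∑ c, t c * _ ≤ ∑ c, r.1 c * _ at h1
    change ∑ c, t c * _ ≤ ∑ c, s.1 c * _ at h2
    change ∑ c, t c * _ ≤ ∑ c, (a * r.1 c + b * s.1 c) * demandRatio (m.greedyState q) c
    simp only [add_mul, Finset.sum_add_distrib, mul_assoc, ← Finset.mul_sum]
    calc _ = a * ∑ c, t c * demandRatio (m.greedyState q) c +
          b * ∑ c, t c * demandRatio (m.greedyState q) c := by rw [← add_mul, hab, one_mul]
      _ ≤ _ := add_le_add (mul_le_mul_of_nonneg_left h1 ha) (mul_le_mul_of_nonneg_left h2 hb)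

lemma coarseResponse_nonempty (m : DigitalMarket A J S) {B : ℝ} (hB : 0 ≤ B)
    {q : CoarseState A J} (hq : q ∈ m.coarseDomain B) : (m.coarseResponse B q).Nonempty := by
  have hx : ∀ i, ∃ z ∈ Set.Icc (0 : Option J → ℝ) (fun _ => B),
      IsQuasiDemand (m.utility i) B q.1 (m.earnings (m.greedyState q) i) z := by
    intro i
    have hcl : IsClosed {z : Option J → ℝ | ∑ c, q.1 c * z c ≤ m.earnings (m.greedyState q) i} :=
      isClosed_le (by fun_prop) continuous_const
    obtain ⟨z, ⟨hz, hzw⟩, hmax⟩ := (isCompact_Icc.inter_right hcl).exists_isMaxOn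
      ⟨(0 : Option J → ℝ), ⟨le_rfl, fun _ => hB⟩, by
        simpa using m.earnings_greedyState_nonneg hq.1.1 (coarseDomain_production_nonneg hq) i⟩
      ((m.utility_continuous i).mono fun z hz => hz.1.1)
    exact ⟨z, hz, hzw, fun z' hz' hlt => hmax ⟨hz', hlt.le⟩⟩
  have hy : ∀ i, ∃ v, m.IsOptimalProduction (m.greedyState q) i v := by
    intro i
    obtain ⟨y, hy, -⟩ := m.feasible_bread i
    have hc : Continuous (m.potentialEarnings (m.greedyState q) i) :=
      (m.continuous_potentialEarnings i).comp (Continuous.prodMk_right q)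
    obtain ⟨v, hv, hmax⟩ := (m.feasible_compact i).exists_isMaxOn ⟨y, hy⟩ hc.continuousOn
    exact ⟨v, hv, fun v' hv' => hmax hv'⟩
  have hc : Continuous (priceObjective (m.greedyState q)) := by
    rw [priceObjective_eq]
    fun_prop
  obtain ⟨p, hp, hmax⟩ := (isCompact_stdSimplex ℝ (Option J)).exists_isMaxOn
    ⟨_, single_mem_stdSimplex ℝ none⟩ hc.continuousOn
  choose x hx hxq using hx
  choose y hy using hy
  exact ⟨(p, x, y), ⟨hp, fun i _ => hx i, fun i _ => (hy i).1⟩, hxq, hy, hmax⟩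

/-- A bundle that costs strictly less than the income in the limit does so eventually along the
sequence, so the comparison of utilities passes to the limit even when the limiting income is 0. -/
lemma isClosed_graph_coarseResponse [Nonempty A] [∀ j, Nonempty (S j)]
    (m : DigitalMarket A J S) (B : ℝ) :
    IsClosed {r : CoarseState A J × CoarseState A J |
      r.1 ∈ m.coarseDomain B ∧ r.2 ∈ m.coarseResponse B r.1} := by
  rw [← isSeqClosed_iff_isClosed]
  intro r s hr hlim
  have hT : IsClosed (m.coarseDomain B) := (m.isCompact_coarseDomain B).isClosed
  have hs1 : s.1 ∈ m.coarseDomain B :=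
    hT.mem_of_tendsto ((continuous_fst.tendsto s).comp hlim) (.of_forall fun n => (hr n).1)
  have hs2 : s.2 ∈ m.coarseDomain B :=
    hT.mem_of_tendsto ((continuous_snd.tendsto s).comp hlim) (.of_forall fun n => (hr n).2.1)
  have hw : ∀ i, Filter.Tendsto (fun n => m.earnings (m.greedyState (r n).1) i) Filter.atTop
      (nhds (m.earnings (m.greedyState s.1) i)) := fun i =>
    (((m.continuous_earnings i).comp continuous_fst).tendsto s).comp hlim
  refine ⟨hs1, hs2, fun i => ⟨?_, fun z hz hlt => ?_⟩, fun i => ⟨hs2.2.2 i trivial,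
    fun v hv => ?_⟩, fun t ht => ?_⟩
  · have hc : Continuous fun s : CoarseState A J × CoarseState A J =>
        ∑ c, s.1.1 c * s.2.2.1 i c := by fun_prop
    exact le_of_tendsto_of_tendsto' ((hc.tendsto s).comp hlim) (hw i)
      fun n => ((hr n).2.2.1 i).1
  · have hc : Continuous fun s : CoarseState A J × CoarseState A J =>
        ∑ c, s.1.1 c * z c := by fun_prop
    have hev := ((hc.tendsto s).comp hlim).eventually_lt (hw i) hlt
    have hu : Filter.Tendsto (fun n => m.utility i ((r n).2.2.1 i)) Filter.atTop
        (nhds (m.utility i (s.2.2.1 i))) := by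
      refine (m.utility_continuous i _ (hs2.2.1 i trivial).1).tendsto.comp
        (tendsto_nhdsWithin_iff.2 ⟨?_, .of_forall fun n => ((hr n).2.1.2.1 i trivial).1⟩)
      have hc : Continuous fun s : CoarseState A J × CoarseState A J => s.2.2.1 i := by fun_prop
      exact (hc.tendsto s).comp hlim
    exact ge_of_tendsto hu (hev.mono fun n hn => ((hr n).2.2.1 i).2 z hz hn)
  · have hc := m.continuous_potentialEarnings i
    have h1 : Continuous fun s : CoarseState A J × CoarseState A J =>
        m.potentialEarnings (m.greedyState s.1) i v :=
      hc.comp (continuous_fst.prodMk continuous_const)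
    have h2 : Continuous fun s : CoarseState A J × CoarseState A J =>
        m.potentialEarnings (m.greedyState s.1) i (s.2.2.2 i) :=
      hc.comp (continuous_fst.prodMk (by fun_prop))
    exact le_of_tendsto_of_tendsto' ((h1.tendsto s).comp hlim) ((h2.tendsto s).comp hlim)
      fun n => ((hr n).2.2.2.1 i).2 v hv
  · have hratio : ∀ c, Filter.Tendsto (fun n => demandRatio (m.greedyState (r n).1) c)
        Filter.atTop (nhds (demandRatio (m.greedyState s.1) c)) := fun c =>
      (m.demandRatio_continuousOn c _ (coarseDomain_production_nonneg hs1)).tendsto.comp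
        (tendsto_nhdsWithin_iff.2 ⟨(continuous_fst.tendsto s).comp hlim,
          .of_forall fun n => coarseDomain_production_nonneg (hr n).1⟩)
    have hprice : ∀ c, Filter.Tendsto (fun n => (r n).2.1 c) Filter.atTop
        (nhds (s.2.1 c)) := by
      intro c
      have hc : Continuous fun s : CoarseState A J × CoarseState A J => s.2.1 c := by fun_prop
      exact (hc.tendsto s).comp hlim
    have hn := fun n => (hr n).2.2.2.2 ht
    simp only [priceObjective_eq] at hn ⊢
    exact le_of_tendsto_of_tendsto'
      (tendsto_finsetSum _ fun c _ => (hratio c).const_mul (t c))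
      (tendsto_finsetSum _ fun c _ => (hprice c).mul (hratio c)) hn

/-- With positive income, shrinking a bundle that just meets the budget makes it strictly cheaper,
and by continuity it remains better if it was better. -/
lemma IsQuasiDemand.le_of_cost_le {u : (Option J → ℝ) → ℝ} {B w : ℝ} {p z : Option J → ℝ}
    (h : IsQuasiDemand u B p w z) (hu : ContinuousOn u (Set.Ici 0)) (hw : 0 < w)
    {z' : Option J → ℝ} (hz' : z' ∈ Set.Icc (0 : Option J → ℝ) fun _ => B)
    (hcost : ∑ c, p c * z' c ≤ w) : u z' ≤ u z := by
  by_contra! hlt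
  obtain ⟨t, ⟨ht0, ht1⟩, ht⟩ := exists_smul_lt hu hz'.1 hlt
  refine absurd (h.2 (t • z') ⟨smul_nonneg ht0.le hz'.1, fun c => ?_⟩ ?_) (not_le.2 ht)
  · exact (mul_le_of_le_one_left (hz'.1 c) ht1.le).trans (hz'.2 c)
  · rw [sum_mul_smul]
    nlinarith

/-- Every market has an equilibrium with normalized prices. -/
theorem exists_isEquilibrium [Nonempty A] [∀ j, Nonempty (S j)] (m : DigitalMarket A J S) :
    ∃ e : MarketState A J S, e.price ∈ stdSimplex ℝ (Option J) ∧ m.IsEquilibrium e := by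
  obtain ⟨M, hM⟩ := m.exists_isSupplyBound
  have hMpos := hM.pos
  set B := 1.1 * M with hB
  have hB0 : 0 ≤ B := by positivity
  have hMB : M < B := by linarith
  obtain ⟨q, hq, -, hqx, hqy, hqp⟩ := exists_mem_self_of_isClosed_graph
    (m.isCompact_coarseDomain B) (m.convex_coarseDomain B) (m.coarseDomain_nonempty hB0)
    (F := m.coarseResponse B) (fun q _ r hr => hr.1)
    (fun q hq => m.coarseResponse_nonempty hB0 hq)
    (fun q hq => m.convex_coarseResponse B hq.1.1) (m.isClosed_graph_coarseResponse B)
  have hp : 0 ≤ q.1 := hq.1.1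
  have hy := coarseDomain_production_nonneg hq
  set e := m.greedyState q with he
  have hfeas : ∀ i, e.production i ∈ m.feasible i := fun i => (hqy i).1
  have h : m.IsBudgetFeasible e :=
    { price_mem := hq.1
      production_nonneg := hy
      amount_nonneg := fun i => (hq.2.1 i trivial).1
      detail_eq := fun _ _ _ => rfl
      budget := fun i => (hqx i).1 }
  have hle := h.amount_le_totalAvailable hqp
  have hM' := amount_le_of_bought_le hM hfeas h.amount_nonneg (h.bought_le_sold hqp none) hle
  -- If bread were free, an agent with positive income would take more of it, so all incomes would
  -- be 0. A category with a positive price would then sell nothing and have ratio 0, below the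
  -- ratio of bread.
  have hbread : 0 < q.1 none := by
    by_contra! hnone
    have hnone : q.1 none = 0 := le_antisymm hnone (hp none)
    have hw : ∀ i, m.earnings e i = 0 := by
      intro i
      by_contra hne
      have hpos : 0 < m.earnings e i :=
        lt_of_le_of_ne (m.earnings_greedyState_nonneg hp hy i) (Ne.symm hne)
      -- Quantities are at most `M`, so `B - M` more units of bread stay inside the box.
      obtain ⟨h1, h2⟩ := utility_lt_add_single (m.utility_nonsatiated i) (h.amount_nonneg i) none
        (sub_pos.2 hMB)
      refine absurd ((hqx i).le_of_cost_le (m.utility_continuous i) hpos ⟨h1, fun c => ?_⟩ ?_)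
        (not_le.2 h2)
      · have h3 : (Pi.single none (B - M) : Option J → ℝ) c ≤ B - M := by
          rw [Pi.single_apply]
          split_ifs <;> linarith
        have h4 := hM' i c
        change e.amount i c + (Pi.single none (B - M) : Option J → ℝ) c ≤ B
        linarith
      · rw [sum_mul_add_single, hnone, zero_mul, add_zero]
        exact (hqx i).1
    have hsum := m.sum_earnings e
    rw [Finset.sum_eq_zero fun i _ => hw i] at hsum
    change 0 = q.1 none * _ + _ at hsum
    rw [hnone, zero_mul, zero_add] at hsum
    obtain ⟨j, hj⟩ : ∃ j, 0 < q.1 (some j) := by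
      by_contra! hall
      have h1 := hq.1.2
      rw [Fintype.sum_option, hnone] at h1
      linarith [Finset.sum_nonpos fun j (_ : j ∈ Finset.univ) => hall j]
    have hj0 := (Finset.sum_eq_zero_iff_of_nonneg fun j _ => mul_nonneg (hp (some j))
      (Finset.sum_nonneg fun k _ => Finset.sum_nonneg fun i _ => h.detail_nonneg i j k)).1
      hsum.symm j (Finset.mem_univ j)
    have hb0 : bought e (some j) = 0 := by
      rw [← (mul_eq_zero.1 hj0).resolve_left hj.ne', Finset.sum_comm]
      exact Finset.sum_congr rfl fun i _ => by rw [h.sum_detail, min_eq_left (hle i j)]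
    rw [priceObjective_eq] at hqp
    obtain ⟨hmax, heq⟩ := hqp.coeff_stdSimplex hq.1
    have h1 := hmax none
    rw [← heq (some j) hj] at h1
    have h2 : demandRatio e (some j) = 0 := by
      simp only [demandRatio, hb0, zero_div]
    -- The 1 added to demand keeps this ratio positive even if no bread is bought.
    have h3 : 0 < demandRatio e none := by
      have := h.sold_none_nonneg
      have : 0 ≤ bought e none := Finset.sum_nonneg fun i _ => h.amount_nonneg i none
      simp only [demandRatio]
      positivity
    linarith
  have hw : ∀ i, 0 < m.earnings e i := by
    intro i
    obtain ⟨v, hv, hvpos⟩ := m.feasible_bread i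
    exact (mul_pos hbread hvpos).trans_le ((m.price_mul_le_potentialEarnings hp hy i
      (m.feasible_nonneg i v hv)).trans ((hqy i).2 v hv))
  refine ⟨e, hq.1, isEquilibrium_of_mem_correspondence hM ⟨mem_domain hM hfeas h
    fun i c => (hq.2.1 i trivial).2 c, fun i => ⟨⟨h.amount_nonneg i, (hqx i).1,
      fun z' hz' hcost => ?_⟩, fun _ _ => rfl⟩, hqy, hqp⟩⟩
  have hz : (fun c => min (e.amount i c) B) = e.amount i :=
    funext fun c => min_eq_left ((hq.2.1 i trivial).2 c)
  change m.utility i (fun c => min (z' c) B) ≤ m.utility i (fun c => min (e.amount i c) B)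
  rw [hz]
  refine (hqx i).le_of_cost_le (m.utility_continuous i) (hw i)
    ⟨fun c => le_min (hz' c) hB0, fun c => min_le_right _ _⟩ (le_trans ?_ hcost)
  exact Finset.sum_le_sum fun c _ => mul_le_mul_of_nonneg_left (min_le_left _ _) (hp c)

end Existence

end DigitalMarket

theorem mainTheorem1 {A J : Type*} {S : J → Type*} [Fintype A] [Fintype J]
    [∀ j, Fintype (S j)] [Nonempty A] [∀ j, Nonempty (S j)] (m : DigitalMarket A J S) :
    (∀ M : ℝ, m.IsSupplyBound M → ∀ e : MarketState A J S,
      e ∈ m.correspondence M e ↔ e.price ∈ stdSimplex ℝ (Option J) ∧ m.IsEquilibrium e) ∧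
    ∃ e : MarketState A J S, e.price ∈ stdSimplex ℝ (Option J) ∧ m.IsEquilibrium e :=
  ⟨fun _ hM _ => ⟨fun he => ⟨he.1.1,
      DigitalMarket.isEquilibrium_of_mem_correspondence hM he⟩,
    fun h => DigitalMarket.IsEquilibrium.mem_correspondence hM h.2 h.1⟩, m.exists_isEquilibrium⟩
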